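/- Consider two queues in tandem: Poisson arrivals of rate $\lambda>0$ at the first queue, independent exponential service times of rates $\mu_1$ and $\mu_2$ at the first and second queue, customers leaving the first queue join the second. Assume $\lambda<\min\{\mu_1,\mu_2\}$ and put $\rho_2=\lambda/\mu_2$. Let the first queue have capacity $m\in\{1,2,\dots\}\cup\{\infty\}$ (arrivals finding it full are rejected), and view the number in the second queue as the level and the number in the first queue as the phase $i\in\{0,\dots,m\}$ ($i\in\{0,1,2,\dots\}$ if $m=\infty$) of a quasi-birth-and-death process, with blocks $Q_0$ ($Q_0(i,i-1)=\mu_1$, other entries $0$), $Q_2=\mu_2 I$, $\tilde Q_1$ ($\tilde Q_1(i,i+1)=\lambda$ for $i<m$, $\tilde Q_1(i,i)=-\lambda 1_{\{i<m\}}-\mu_1 1_{\{i>0\}}$, other entries $0$) and $Q_1=\tilde Q_1-\mu_2 I$; from level $k$ the process moves to level $k+1$ with rates $Q_0$, to level $k-1$ (if $k\ge1$) with rates $Q_2$, and the diagonal block of the generator is $\tilde Q_1$ at level $0$ and $Q_1$ at levels $k\ge 1$. The function $\tau(z)=-\lambda-\mu_1-\mu_2(1-z)+2\sqrt{\lambda\mu_1/z}$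 has a unique zero $\eta$ in $(0,1)$. For each finite $m\ge1$ the equation $Q_0+RQ_1+R^2Q_2=0$ has a minimal nonnegative solution $R_m$, and $R_m$ has a Perron–Frobenius eigenvalue $r_m$, that is, a positive simple eigenvalue that is at least the modulus of every eigenvalue of $R_m$ and has a strictly positive left eigenvector. Moreover: 1. If $\mu_1\le\mu_2$, then $r_1,r_2,\dots$ increases strictly to $\eta$. 2. If $\mu_1>\mu_2$, then $r_1,r_2,\dots$ increases strictly to $\rho_2$. 3. Say that a system has decay rate $z>0$ if it has a unique stationary distribution and, under it, $\mathbb P(\text{level}=K)/z^K$ tends to a positive constant as $K\to\infty$. Then for each finite $m\ge1$ the system with capacity $m$ has decay rate $r_m$, and the system with $m=\infty$ has decay rate $\rho_2$. Hence, when $\mu_1<\mu_2$, the limit $\lim_{m\to\infty}r_m$ of the decay rates of the truncated systems exists and differs from the decay rate $\rho_2$ of the infinite system. -/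

import Mathlib

open Filter Topology

noncomputable section

/-- The blocks `Q₀`, `Q₁`, `Q₂`, `Q̃₁` of a level-independent quasi-birth-and-death process with
phase space `ι`. -/
structure QBDBlocks (ι : Type) where
  /-- rates for moving one level up -/
  Q0 : Matrix ι ι ℝ
  /-- rates inside a level `k ≥ 1` (with the diagonal entries of the generator) -/
  Q1 : Matrix ι ι ℝ
  /-- rates for moving one level down -/
  Q2 : Matrix ι ι ℝ
  /-- rates inside level `0` (with the diagonal entries of the generator) -/
  Qt1 : Matrix ι ι ℝ

/-- The block-tridiagonal generator on the state space of pairs (level, phase). -/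
def QBDBlocks.generator {ι : Type} (B : QBDBlocks ι) : Matrix (ℕ × ι) (ℕ × ι) ℝ :=
  fun x y =>
    if y.1 = x.1 + 1 then B.Q0 x.2 y.2
    else if y.1 = x.1 then (if x.1 = 0 then B.Qt1 x.2 y.2 else B.Q1 x.2 y.2)
    else if x.1 = y.1 + 1 then B.Q2 x.2 y.2
    else 0

/-- `R` is Neuts's `R`-matrix: the minimal nonnegative solution of `Q₀ + R Q₁ + R² Q₂ = 0`. -/
structure QBDBlocks.IsNeutsR {ι : Type} [Fintype ι] (B : QBDBlocks ι) (R : Matrix ι ι ℝ) :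
    Prop where
  nonneg : ∀ i j, 0 ≤ R i j
  equation : B.Q0 + R * B.Q1 + R * R * B.Q2 = 0
  minimal : ∀ S : Matrix ι ι ℝ, (∀ i j, 0 ≤ S i j) →
    B.Q0 + S * B.Q1 + S * S * B.Q2 = 0 → ∀ i j, R i j ≤ S i j

/-- `p` is a stationary distribution of the continuous-time Markov chain with generator `G`:
a probability vector with `p G = 0`. (All generators used here have bounded rates.) -/
structure IsStationaryDistribution {S : Type} (G : Matrix S S ℝ) (p : S → ℝ) : Prop where
  nonneg : ∀ x, 0 ≤ p x
  total : HasSum p 1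
  balance : ∀ y, HasSum (fun x => p x * G x y) 0

/-- The marginal distribution of the level. -/
def levelMarginal {ι : Type} (p : ℕ × ι → ℝ) (k : ℕ) : ℝ := ∑' i, p (k, i)

/-- The sequence `a` decays geometrically at rate `z`: `a k / z ^ k` tends to a positive constant. -/
def HasDecayRate (a : ℕ → ℝ) (z : ℝ) : Prop :=
  0 < z ∧ ∃ c : ℝ, 0 < c ∧ Tendsto (fun k => a k / z ^ k) atTop (𝓝 c)

/-- The process has exactly one stationary distribution, and its level marginal decays
geometrically at rate `z`. -/
def QBDBlocks.HasStationaryDecayRate {ι : Type} (B : QBDBlocks ι) (z : ℝ) : Prop :=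
  ∃ p : ℕ × ι → ℝ, IsStationaryDistribution B.generator p ∧
    (∀ p', IsStationaryDistribution B.generator p' → p' = p) ∧
    HasDecayRate (levelMarginal p) z

/-- `r` is the Perron–Frobenius eigenvalue of `A`: a positive simple eigenvalue, at least as large
as the modulus of every complex eigenvalue, with a strictly positive left eigenvector. -/
structure IsPerronFrobeniusEigenvalue {ι : Type} [Fintype ι] [DecidableEq ι]
    (A : Matrix ι ι ℝ) (r : ℝ) : Prop where
  pos : 0 < r
  simple : A.charpoly.rootMultiplicity r = 1
  dominant : ∀ z : ℂ, z ∈ spectrum ℂ (A.map (algebraMap ℝ ℂ)) → ‖z‖ ≤ r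
  eigenvector : ∃ w : ι → ℝ, (∀ i, 0 < w i) ∧ Matrix.vecMul w A = r • w

/-- The tandem network with arrival rate `lam`, service rates `μ₁`, `μ₂`, and capacity `cap` of the
first queue. The phase `i` stands for `φ i` customers in the first queue; the level is the number
of customers in the second queue. Arrivals at a full first queue are rejected. -/
def tandemBlocks (lam μ₁ μ₂ : ℝ) (cap : ℕ∞) {ι : Type} (φ : ι → ℕ) : QBDBlocks ι where
  Q0 := fun i j => if φ i = φ j + 1 then μ₁ else 0
  Q1 := fun i j =>
    if φ j = φ i + 1 then lam
    else if φ j = φ i then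
      -((if (φ i : ℕ∞) < cap then lam else 0) + (if 0 < φ i then μ₁ else 0) + μ₂)
    else 0
  Q2 := fun i j => if φ j = φ i then μ₂ else 0
  Qt1 := fun i j =>
    if φ j = φ i + 1 then lam
    else if φ j = φ i then
      -((if (φ i : ℕ∞) < cap then lam else 0) + (if 0 < φ i then μ₁ else 0))
    else 0

/-- The tandem network whose first queue has finite capacity `m`; phases `0, …, m`. -/
def finiteTandem (lam μ₁ μ₂ : ℝ) (m : ℕ) : QBDBlocks (Fin (m + 1)) :=
  tandemBlocks lam μ₁ μ₂ m (fun i => (i : ℕ))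

/-- The tandem network whose first queue has unlimited capacity; phases `0, 1, 2, …`. -/
def infiniteTandem (lam μ₁ μ₂ : ℝ) : QBDBlocks ℕ :=
  tandemBlocks lam μ₁ μ₂ ⊤ (fun i => i)

/-- `τ(z) = -λ - μ₁ - μ₂ (1 - z) + 2 √(λ μ₁ / z)`. -/
def tandemTau (lam μ₁ μ₂ z : ℝ) : ℝ :=
  -lam - μ₁ - μ₂ * (1 - z) + 2 * Real.sqrt (lam * μ₁ / z)

end

/-! Every `r_m` is a smallest number admitting a positive superinvariant vector. If `w > 0` and `w
(Q₀ + z Q₁ + z² Q₂) ≤ 0`, then the monotone iteration from `0` that produces `R` preserves `w R ≤ z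
w`; comparing `w` with the Perron–Frobenius eigenvector of `R_m` gives `r_m ≤ z`. Conversely, that
eigenvector is annihilated by the pencil at `z = r_m`. Since the pencil is tridiagonal in the phase,
its left null vectors are multiples of one sequence, `tandemSeq`, given by a three-term recurrence,
and capacity `m` enters only through the boundary condition at phase `m`. The row of `R_m` for an
empty first queue vanishes and all other rows are positive, so `R_m` is reducible, but the
Perron–Frobenius arguments still go through.

The null sequence for capacity `m + 1`, cut at `m`, satisfies the boundary inequality for `m`
strictly; hence `r_m < r_{m+1}`. The geometric vector with ratio `λ/μ₁` is superinvariant at `ρ₂`,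
so `r_m < ρ₂` and the limit `L` exists. At `L` the sequence `tandemSeq` is positive for all indices.
The ratios `x` of consecutive terms of `tandemSeq` drop at each step by a multiple of `μ₁ x / z + λ
/ x - s`, with `s = λ + μ₁ + μ₂ (1 - z)`. This is at least `τ(z)`, so positivity forces `τ(L) ≤ 0`,
that is `L ≥ η`. If `μ₁ ≤ μ₂`, the geometric vector given by the double root of the characteristic
equation at `η` is superinvariant, whence `L = η`. If `μ₁ > μ₂`, then `η ≥ λ/μ₁`, and for `z` in
`[λ/μ₁, ρ₂)` the initial ratio is so small that the ratios decrease until positivity fails; thus `L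
= ρ₂`.

For finite `m` the stationary law is matrix-geometric, `p₀ Rᵏ`, and thus decays at rate `r_m`; for
`m = ∞` it is Jackson's product form, which decays at rate `ρ₂`. Finally `τ(ρ₂) = -(√μ₁ - √μ₂)²`, so
`η ≠ ρ₂` when `μ₁ ≠ μ₂`. -/

/-! ### Uniqueness of stationary distributions -/

/-- `U` is closed under the transitions of the generator `G`. -/
def IsTransitionClosed {S : Type} (G : Matrix S S ℝ) (U : Set S) : Prop :=
  ∀ x ∈ U, ∀ y, x ≠ y → 0 < G x y → y ∈ U

/-- `G` is the generator of an irreducible continuous-time Markov chain with bounded rates. -/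
structure IsBoundedIrreducibleGenerator {S : Type} (G : Matrix S S ℝ) : Prop where
  offDiag_nonneg : ∀ x y, x ≠ y → 0 ≤ G x y
  row_sum : ∀ x, HasSum (G x) 0
  bounded : ∃ C : ℝ, ∀ x, |G x x| ≤ C
  irreducible : ∀ U : Set S, U.Nonempty → IsTransitionClosed G U → U = Set.univ

/-- A nonnegative invariant vector of an irreducible generator is zero or strictly positive. -/
theorem IsBoundedIrreducibleGenerator.invariant_pos_or_zero {S : Type} {G : Matrix S S ℝ}
    (hG : IsBoundedIrreducibleGenerator G) {p : S → ℝ} (hp : ∀ x, 0 ≤ p x)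
    (hbal : ∀ y, HasSum (fun x => p x * G x y) 0) : (∀ x, 0 < p x) ∨ (∀ x, p x = 0) := by
  by_cases h : ∃ x, 0 < p x
  · left
    have hU := hG.irreducible {x | 0 < p x} h (by
      intro x hx y hxy hGxy
      by_contra hy
      have hy0 : p y = 0 := le_antisymm (not_lt.mp hy) (hp y)
      have hnn : ∀ z, 0 ≤ p z * G z y := by
        intro z
        by_cases hzy : z = y
        · rw [hzy, hy0, zero_mul]
        · exact mul_nonneg (hp z) (hG.offDiag_nonneg z y hzy)
      have h0 := congrFun ((hasSum_zero_iff_of_nonneg hnn).mp (hbal y)) x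
      exact (mul_pos hx hGxy).ne' h0)
    intro x
    have : x ∈ {x | 0 < p x} := by rw [hU]; trivial
    exact this
  · right
    intro x
    exact le_antisymm (not_lt.mp fun hx => h ⟨x, hx⟩) (hp x)

/-- The entrywise absolute value of a summable invariant vector is invariant. -/
theorem IsBoundedIrreducibleGenerator.abs_invariant {S : Type} {G : Matrix S S ℝ}
    (hG : IsBoundedIrreducibleGenerator G) {d : S → ℝ} (hd : Summable d)
    (hbal : ∀ y, HasSum (fun x => d x * G x y) 0) :
    ∀ y, HasSum (fun x => |d x| * G x y) 0 := by
  classical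
  obtain ⟨C, hC⟩ := hG.bounded
  have hrow : ∀ x, Summable fun y => |G x y| := fun x => (hG.row_sum x).summable.abs
  have hrowle : ∀ x, ∑' y, |G x y| ≤ 2 * C := by
    intro x
    -- The right side equals `|G x y|` and sums to `|G x x| - G x x`, because the row sum is zero.
    have h2 : ∀ y, |G x y| ≤ 2 * (if y = x then |G x x| else 0) + G x y +
        if y = x then -(G x x) - |G x x| else 0 := by
      intro y
      by_cases hy : y = x
      · subst hy; simp; linarith
      · simp [hy, abs_of_nonneg (hG.offDiag_nonneg x y (Ne.symm hy))]
    have h3 := ((((hasSum_ite_eq x (|G x x|)).mul_left 2).add (hG.row_sum x)).add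
      (hasSum_ite_eq x (-(G x x) - |G x x|)))
    have h4 := hasSum_le h2 (hrow x).hasSum h3
    have h5 := neg_abs_le (G x x)
    linarith [hC x]
  -- Bounded rates make the double series absolutely convergent, so its row-wise total, zero, is
  -- also its column-wise total. Columns with nonnegative sums must then all vanish.
  have hF : Summable fun q : S × S => |d q.1| * G q.1 q.2 := by
    apply Summable.of_abs
    rw [summable_prod_of_nonneg (fun q => abs_nonneg _)]
    simp only [abs_mul, abs_abs]
    refine ⟨fun x => (hrow x).mul_left _, ?_⟩
    simp only [tsum_mul_left]
    refine Summable.of_nonneg_of_le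
      (fun x => mul_nonneg (abs_nonneg _) (tsum_nonneg fun _ => abs_nonneg _))
      (fun x => mul_le_mul_of_nonneg_left (hrowle x) (abs_nonneg _)) (hd.abs.mul_right _)
  have htot : HasSum (fun q : S × S => |d q.1| * G q.1 q.2) 0 := by
    have h1 := hF.hasSum.prod_fiberwise (fun x => (hG.row_sum x).mul_left |d x|)
    simp only [mul_zero] at h1
    rw [← h1.unique hasSum_zero]
    exact hF.hasSum
  have hF' : Summable fun q : S × S => |d q.2| * G q.2 q.1 := hF.prod_symm
  have htot' : HasSum (fun q : S × S => |d q.2| * G q.2 q.1) 0 := by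
    have := (Equiv.prodComm S S).hasSum_iff.mpr htot
    exact this
  have hcol : ∀ y, Summable fun x => |d x| * G x y := fun y => hF'.prod_factor y
  have hsum := htot'.prod_fiberwise (fun y => (hcol y).hasSum)
  have hnn : ∀ y, 0 ≤ ∑' x, |d x| * G x y := by
    intro y
    -- Multiplying the balance equation at `y` by the sign `ε` of `d y` makes the diagonal term `|d
    -- y| G y y`; the other terms only grow when absolute values are taken.
    have hs : ∃ ε : ℝ, |ε| = 1 ∧ ε * d y = |d y| := by
      rcases le_total 0 (d y) with h | h
      · exact ⟨1, by simp, by rw [abs_of_nonneg h, one_mul]⟩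
      · exact ⟨-1, by simp, by rw [abs_of_nonpos h]; ring⟩
    obtain ⟨ε, hε, hεd⟩ := hs
    have h1 := (hbal y).mul_left ε
    rw [mul_zero] at h1
    refine hasSum_le (fun x => ?_) h1 (hcol y).hasSum
    by_cases hxy : x = y
    · subst hxy; rw [← mul_assoc, hεd]
    · rw [← mul_assoc]
      refine mul_le_mul_of_nonneg_right ?_ (hG.offDiag_nonneg x y hxy)
      calc ε * d x ≤ |ε * d x| := le_abs_self _
        _ = |d x| := by rw [abs_mul, hε, one_mul]
  have hz := (hasSum_zero_iff_of_nonneg hnn).mp hsum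
  intro y
  have h := (hcol y).hasSum
  rwa [show ∑' x, |d x| * G x y = 0 from congrFun hz y] at h

/-- For the difference `d` of two stationary laws, `|d| + d` is invariant and nonnegative, hence
positive everywhere or zero everywhere. Either way `d` has constant sign, and its total mass is
zero. -/
theorem IsBoundedIrreducibleGenerator.stationary_unique {S : Type} {G : Matrix S S ℝ}
    (hG : IsBoundedIrreducibleGenerator G) {p p' : S → ℝ}
    (hp : IsStationaryDistribution G p) (hp' : IsStationaryDistribution G p') : p' = p := by
  have hd : HasSum (fun x => p' x - p x) 0 := by
    simpa using hp'.total.sub hp.total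
  have hbal : ∀ y, HasSum (fun x => (p' x - p x) * G x y) 0 := by
    intro y
    simpa [sub_mul] using (hp'.balance y).sub (hp.balance y)
  have habs := hG.abs_invariant hd.summable hbal
  have hplus : ∀ y, HasSum (fun x => (|p' x - p x| + (p' x - p x)) * G x y) 0 := by
    intro y
    simpa [add_mul] using (habs y).add (hbal y)
  have hnn : ∀ x, 0 ≤ |p' x - p x| + (p' x - p x) := fun x => by
    linarith [neg_abs_le (p' x - p x)]
  rcases hG.invariant_pos_or_zero hnn hplus with h | h
  · have hpos : ∀ x, 0 ≤ p' x - p x := by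
      intro x
      by_contra hx
      have := h x
      rw [abs_of_neg (not_le.mp hx)] at this
      linarith
    have := (hasSum_zero_iff_of_nonneg hpos).mp hd
    funext x
    have := congrFun this x
    simp only [Pi.zero_apply] at this
    linarith
  · have hneg : ∀ x, 0 ≤ -(p' x - p x) := by
      intro x
      have := h x
      linarith [abs_nonneg (p' x - p x)]
    have h0 : HasSum (fun x => -(p' x - p x)) 0 := by simpa using hd.neg
    have := (hasSum_zero_iff_of_nonneg hneg).mp h0
    funext x
    have := congrFun this x
    simp only [Pi.zero_apply] at this
    linarith

/-! ### The minimal nonnegative solution of the matrix equation -/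

theorem Matrix.mul_entry_nonneg {ι : Type} [Fintype ι] {A B : Matrix ι ι ℝ}
    (hA : ∀ i j, 0 ≤ A i j) (hB : ∀ i j, 0 ≤ B i j) (i j : ι) : 0 ≤ (A * B) i j := by
  rw [Matrix.mul_apply]
  exact Finset.sum_nonneg fun k _ => mul_nonneg (hA i k) (hB k j)

theorem Matrix.mul_entry_mono {ι : Type} [Fintype ι] {A A' B B' : Matrix ι ι ℝ}
    (hA : ∀ i j, 0 ≤ A i j) (hAA : ∀ i j, A i j ≤ A' i j) (hB : ∀ i j, 0 ≤ B i j)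
    (hBB : ∀ i j, B i j ≤ B' i j) (i j : ι) : (A * B) i j ≤ (A' * B') i j := by
  rw [Matrix.mul_apply, Matrix.mul_apply]
  exact Finset.sum_le_sum fun k _ =>
    mul_le_mul (hAA i k) (hBB k j) (hB k j) ((hA i k).trans (hAA i k))

theorem Matrix.vecMul_mono {ι : Type} [Fintype ι] {v v' : ι → ℝ} {A : Matrix ι ι ℝ}
    (hA : ∀ i j, 0 ≤ A i j) (hv : ∀ i, v i ≤ v' i) (j : ι) :
    (Matrix.vecMul v A) j ≤ (Matrix.vecMul v' A) j := by
  simp only [Matrix.vecMul, dotProduct]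
  exact Finset.sum_le_sum fun k _ => mul_le_mul_of_nonneg_right (hv k) (hA k j)

theorem Matrix.vecMul_entry_nonneg {ι : Type} [Fintype ι] {v : ι → ℝ} {A : Matrix ι ι ℝ}
    (hA : ∀ i j, 0 ≤ A i j) (hv : ∀ i, 0 ≤ v i) (j : ι) : 0 ≤ (Matrix.vecMul v A) j := by
  simp only [Matrix.vecMul, dotProduct]
  exact Finset.sum_nonneg fun k _ => mul_nonneg (hv k) (hA k j)

/-- The uniformized fixed point map of the matrix equation `Q₀ + R Q₁ + R² Q₂ = 0`. -/
noncomputable def QBDBlocks.neutsStep {ι : Type} [Fintype ι] [DecidableEq ι]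
    (B : QBDBlocks ι) (ν : ℝ) (R : Matrix ι ι ℝ) : Matrix ι ι ℝ :=
  ν⁻¹ • (B.Q0 + R * (B.Q1 + ν • 1) + R * R * B.Q2)

/-- The matrix polynomial `Q₀ + z Q₁ + z² Q₂`. -/
noncomputable def QBDBlocks.pencil {ι : Type} (B : QBDBlocks ι) (z : ℝ) : Matrix ι ι ℝ :=
  B.Q0 + z • B.Q1 + z ^ 2 • B.Q2

/-- The sign conditions on the blocks of a quasi-birth-and-death process. -/
structure QBDBlocks.IsMetzler {ι : Type} (B : QBDBlocks ι) : Prop where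
  Q0_nonneg : ∀ i j, 0 ≤ B.Q0 i j
  Q1_offDiag_nonneg : ∀ i j, i ≠ j → 0 ≤ B.Q1 i j
  Q2_nonneg : ∀ i j, 0 ≤ B.Q2 i j

section MinimalSolution

variable {ι : Type} [Fintype ι] [DecidableEq ι] {B : QBDBlocks ι} {ν : ℝ}

theorem QBDBlocks.neutsStep_eq_iff (hν : 0 < ν) (R : Matrix ι ι ℝ) :
    B.neutsStep ν R = R ↔ B.Q0 + R * B.Q1 + R * R * B.Q2 = 0 := by
  have h : B.neutsStep ν R = R + ν⁻¹ • (B.Q0 + R * B.Q1 + R * R * B.Q2) := by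
    rw [QBDBlocks.neutsStep, mul_add, mul_smul_comm, mul_one]
    have : ν⁻¹ • (ν • R) = R := by rw [smul_smul, inv_mul_cancel₀ hν.ne', one_smul]
    nth_rw 5 [← this]
    rw [← smul_add]
    congr 1
    abel
  rw [h, add_eq_left, smul_eq_zero]
  simp [hν.ne']

theorem QBDBlocks.neutsStep_nonneg (hB : B.IsMetzler) (hν : 0 < ν)
    (hK : ∀ i j, 0 ≤ (B.Q1 + ν • 1) i j) {R : Matrix ι ι ℝ} (hR : ∀ i j, 0 ≤ R i j) (i j : ι) :
    0 ≤ B.neutsStep ν R i j := by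
  simp only [QBDBlocks.neutsStep, Matrix.smul_apply, Matrix.add_apply (_ + _) _,
    Matrix.add_apply B.Q0 _, smul_eq_mul]
  have h1 := Matrix.mul_entry_nonneg hR hK i j
  have h2 := Matrix.mul_entry_nonneg (Matrix.mul_entry_nonneg hR hR) hB.Q2_nonneg i j
  have h3 := hB.Q0_nonneg i j
  positivity

theorem QBDBlocks.neutsStep_mono (hB : B.IsMetzler) (hν : 0 < ν)
    (hK : ∀ i j, 0 ≤ (B.Q1 + ν • 1) i j) {R S : Matrix ι ι ℝ} (hR : ∀ i j, 0 ≤ R i j)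
    (hRS : ∀ i j, R i j ≤ S i j) (i j : ι) : B.neutsStep ν R i j ≤ B.neutsStep ν S i j := by
  simp only [QBDBlocks.neutsStep, Matrix.smul_apply, Matrix.add_apply (_ + _) _,
    Matrix.add_apply B.Q0 _, smul_eq_mul]
  have h1 := Matrix.mul_entry_mono hR hRS hK (fun _ _ => le_rfl) i j
  have h2 := Matrix.mul_entry_mono (Matrix.mul_entry_nonneg hR hR)
    (Matrix.mul_entry_mono hR hRS hR hRS) hB.Q2_nonneg (fun _ _ => le_rfl) i j
  have : 0 ≤ ν⁻¹ := by positivity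
  gcongr

/-- From `w R ≤ z w` follows `w R² ≤ z² w`, so the step maps `w` to at most `z w + ν⁻¹ w (Q₀ + z Q₁
+ z² Q₂) ≤ z w`. This induction step turns superinvariance for the pencil into an upper bound for
the minimal solution. -/
theorem QBDBlocks.vecMul_neutsStep_le (hB : B.IsMetzler) (hν : 0 < ν)
    (hK : ∀ i j, 0 ≤ (B.Q1 + ν • 1) i j) {R : Matrix ι ι ℝ} (hR : ∀ i j, 0 ≤ R i j)
    {z : ℝ} (hz : 0 ≤ z) {w : ι → ℝ}
    (hw : ∀ j, (Matrix.vecMul w (B.pencil z)) j ≤ 0)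
    (hwR : ∀ j, (Matrix.vecMul w R) j ≤ z * w j) (j : ι) :
    (Matrix.vecMul w (B.neutsStep ν R)) j ≤ z * w j := by
  have hwR' : ∀ j, (Matrix.vecMul w R) j ≤ (z • w) j := fun j => by simpa using hwR j
  have h1 := Matrix.vecMul_mono hK hwR' j
  have h2 : ∀ j, (Matrix.vecMul w (R * R)) j ≤ (z ^ 2 • w) j := by
    intro j
    rw [← Matrix.vecMul_vecMul]
    refine (Matrix.vecMul_mono hR hwR' j).trans ?_
    simp only [Matrix.smul_vecMul, Pi.smul_apply, smul_eq_mul]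
    calc z * Matrix.vecMul w R j ≤ z * (z * w j) := mul_le_mul_of_nonneg_left (hwR j) hz
      _ = z ^ 2 * w j := by ring
  have h3 := Matrix.vecMul_mono hB.Q2_nonneg h2 j
  have h4 := hw j
  simp only [QBDBlocks.pencil, QBDBlocks.neutsStep, Matrix.vecMul_add, Matrix.vecMul_smul,
    Matrix.smul_vecMul, Matrix.vecMul_vecMul, Matrix.vecMul_one, Pi.add_apply, Pi.smul_apply,
    smul_eq_mul] at h1 h2 h3 h4 ⊢
  rw [inv_mul_le_iff₀ hν]
  simp only [mul_add, Matrix.vecMul_add, Matrix.vecMul_smul, mul_smul_comm, mul_one,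
    Pi.add_apply, Pi.smul_apply, smul_eq_mul] at h1 h3 ⊢
  linarith

/-- Neuts's matrix exists as soon as the phase process has a strictly positive superinvariant
vector. It is dominated by every `z` with a strictly positive `w` such that
`w (Q₀ + z Q₁ + z² Q₂) ≤ 0`, and it inherits the zero rows of `Q₀`. -/
theorem QBDBlocks.exists_isNeutsR (hB : B.IsMetzler) {w₁ : ι → ℝ} (hw₁ : ∀ i, 0 < w₁ i)
    (hw₁Q : ∀ j, (Matrix.vecMul w₁ (B.pencil 1)) j ≤ 0) :
    ∃ R : Matrix ι ι ℝ, B.IsNeutsR R ∧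
      (∀ i, (∀ j, B.Q0 i j = 0) → ∀ j, R i j = 0) ∧
      ∀ (z : ℝ) (w : ι → ℝ), 0 ≤ z → (∀ i, 0 < w i) →
        (∀ j, (Matrix.vecMul w (B.pencil z)) j ≤ 0) → ∀ j, (Matrix.vecMul w R) j ≤ z * w j := by
  obtain ⟨ν, hν, hK⟩ : ∃ ν : ℝ, 0 < ν ∧ ∀ i j, 0 ≤ (B.Q1 + ν • 1) i j := by
    -- Any `ν` exceeding all diagonal rates makes `Q₁ + ν I` nonnegative, so that `neutsStep` is
    -- monotone.
    refine ⟨1 + ∑ i, |B.Q1 i i|, by positivity, fun i j => ?_⟩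
    rw [Matrix.add_apply, Matrix.smul_apply, smul_eq_mul]
    by_cases hij : i = j
    · subst hij
      have h1 := Finset.single_le_sum (f := fun i => |B.Q1 i i|) (fun i _ => abs_nonneg _)
        (Finset.mem_univ i)
      rw [Matrix.one_apply_eq]
      linarith [neg_abs_le (B.Q1 i i)]
    · rw [Matrix.one_apply_ne hij, mul_zero, add_zero]
      exact hB.Q1_offDiag_nonneg i j hij
  set T : ℕ → Matrix ι ι ℝ := fun n => (B.neutsStep ν)^[n] 0 with hT
  have hT0 : T 0 = 0 := rfl
  have hTs : ∀ n, T (n + 1) = B.neutsStep ν (T n) := fun n => Function.iterate_succ_apply' _ _ _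
  have hTnn : ∀ n i j, 0 ≤ T n i j := by
    intro n
    induction n with
    | zero => intro i j; rw [hT0]; exact le_rfl
    | succ n ih => rw [hTs]; exact QBDBlocks.neutsStep_nonneg hB hν hK ih
  have hTmono : ∀ n i j, T n i j ≤ T (n + 1) i j := by
    intro n
    induction n with
    | zero => intro i j; rw [hT0]; exact hTnn 1 i j
    | succ n ih =>
      intro i j
      rw [hTs n, hTs (n + 1)]
      exact QBDBlocks.neutsStep_mono hB hν hK (hTnn n) ih i j
  have hTw : ∀ (z : ℝ) (w : ι → ℝ), 0 ≤ z → (∀ i, 0 < w i) →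
      (∀ j, (Matrix.vecMul w (B.pencil z)) j ≤ 0) →
      ∀ n j, (Matrix.vecMul w (T n)) j ≤ z * w j := by
    intro z w hz hw hwQ n
    induction n with
    | zero => intro j; rw [hT0, Matrix.vecMul_zero]; exact mul_nonneg hz (hw j).le
    | succ n ih => rw [hTs]; exact QBDBlocks.vecMul_neutsStep_le hB hν hK (hTnn n) hz hwQ ih
  have hTle : ∀ S : Matrix ι ι ℝ, (∀ i j, 0 ≤ S i j) →
      B.Q0 + S * B.Q1 + S * S * B.Q2 = 0 → ∀ n i j, T n i j ≤ S i j := by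
    intro S hS hSeq n
    induction n with
    | zero => intro i j; rw [hT0]; exact hS i j
    | succ n ih =>
      intro i j
      rw [hTs, ← (QBDBlocks.neutsStep_eq_iff hν S).mpr hSeq]
      exact QBDBlocks.neutsStep_mono hB hν hK (hTnn n) ih i j
  have hTrow : ∀ i, (∀ j, B.Q0 i j = 0) → ∀ n j, T n i j = 0 := by
    intro i hi n
    induction n with
    | zero => intro j; rw [hT0]; rfl
    | succ n ih =>
      intro j
      rw [hTs, QBDBlocks.neutsStep, mul_assoc]
      simp [Matrix.mul_apply, hi, ih]
  -- The bound `w₁ T ≤ w₁`, read on a single summand, gives `T i j ≤ w₁ j / w₁ i`; so the increasing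
  -- iterates converge.
  have hbdd : ∀ i j, BddAbove (Set.range fun n => T n i j) := by
    intro i j
    refine ⟨w₁ j / w₁ i, ?_⟩
    rintro _ ⟨n, rfl⟩
    have h1 := hTw 1 w₁ zero_le_one hw₁ hw₁Q n j
    have h2 : w₁ i * T n i j ≤ Matrix.vecMul w₁ (T n) j :=
      Finset.single_le_sum (f := fun k => w₁ k * T n k j)
        (fun k _ => mul_nonneg (hw₁ k).le (hTnn n k j)) (Finset.mem_univ i)
    rw [le_div_iff₀ (hw₁ i)]
    linarith
  set R : Matrix ι ι ℝ := fun i j => ⨆ n, T n i j with hR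
  have hlim' : ∀ i j, Tendsto (fun n => T n i j) atTop (𝓝 (R i j)) := fun i j =>
    tendsto_atTop_ciSup (monotone_nat_of_le_succ fun n => hTmono n i j) (hbdd i j)
  have hlim : Tendsto T atTop (𝓝 R) :=
    tendsto_pi_nhds.mpr fun i => tendsto_pi_nhds.mpr fun j => hlim' i j
  have hcont : Continuous (B.neutsStep ν) := by
    unfold QBDBlocks.neutsStep
    fun_prop
  have hfix : B.neutsStep ν R = R := by
    have h1 : Tendsto (fun n => T (n + 1)) atTop (𝓝 R) := hlim.comp (tendsto_add_atTop_nat 1)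
    have h2 : Tendsto (fun n => T (n + 1)) atTop (𝓝 (B.neutsStep ν R)) := by
      simp only [hTs]
      exact (hcont.tendsto R).comp hlim
    exact tendsto_nhds_unique h2 h1
  refine ⟨R, ⟨?_, (QBDBlocks.neutsStep_eq_iff hν R).mp hfix, ?_⟩, ?_, ?_⟩
  · exact fun i j => ge_of_tendsto' (hlim' i j) fun n => hTnn n i j
  · exact fun S hS hSeq i j => le_of_tendsto' (hlim' i j) fun n => hTle S hS hSeq n i j
  · intro i hi j
    refine tendsto_nhds_unique (hlim' i j) ?_
    simp only [hTrow i hi]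
    exact tendsto_const_nhds
  · intro z w hz hw hwQ j
    have h1 : Tendsto (fun n => Matrix.vecMul w (T n) j) atTop (𝓝 (Matrix.vecMul w R j)) := by
      simp only [Matrix.vecMul, dotProduct]
      exact tendsto_finsetSum _ fun i _ => (hlim' i j).const_mul _
    exact le_of_tendsto' h1 fun n => hTw z w hz hw hwQ n j

end MinimalSolution

/-! ### Perron–Frobenius theory with zero rows allowed -/

section PerronFrobenius

variable {ι : Type} [Fintype ι] {A : Matrix ι ι ℝ}

theorem exists_pos_le_mul {x w : ι → ℝ} (hw : ∀ i, 0 < w i) :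
    ∃ C : ℝ, 0 < C ∧ ∀ i, |x i| ≤ C * w i := by
  refine ⟨1 + ∑ i, |x i| / w i, ?_, fun i => ?_⟩
  · have : 0 ≤ ∑ i, |x i| / w i :=
      Finset.sum_nonneg fun i _ => div_nonneg (abs_nonneg _) (hw i).le
    linarith
  · have h1 := Finset.single_le_sum (f := fun i => |x i| / w i)
      (fun i _ => div_nonneg (abs_nonneg _) (hw i).le) (Finset.mem_univ i)
    rw [← div_le_iff₀ (hw i)]
    linarith

/-- Comparison of a subinvariant with a strictly positive superinvariant vector. -/
theorem le_of_subinvariant_of_superinvariant (hA : ∀ i j, 0 ≤ A i j) {x w : ι → ℝ} {s r : ℝ}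
    (hx : ∀ i, 0 ≤ x i) (hx0 : ∃ i, x i ≠ 0) (hxA : ∀ j, s * x j ≤ Matrix.vecMul x A j)
    (hw : ∀ i, 0 < w i) (hwA : ∀ j, Matrix.vecMul w A j ≤ r * w j) : s ≤ r := by
  obtain ⟨i₁, hi₁⟩ := hx0
  have : Nonempty ι := ⟨i₁⟩
  -- `C w` is the least multiple of `w` above `x` and touches it at `i₀`; the two inequalities are
  -- compared there.
  obtain ⟨i₀, hi₀⟩ := Finite.exists_max fun i => x i / w i
  set C := x i₀ / w i₀ with hC
  have hle : ∀ i, x i ≤ (C • w) i := by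
    intro i
    rw [Pi.smul_apply, smul_eq_mul, ← div_le_iff₀ (hw i)]
    exact hi₀ i
  have hCpos : 0 < C :=
    lt_of_lt_of_le (div_pos (lt_of_le_of_ne (hx i₁) (Ne.symm hi₁)) (hw i₁)) (hi₀ i₁)
  have h1 := (hxA i₀).trans (Matrix.vecMul_mono hA hle i₀)
  rw [Matrix.smul_vecMul, Pi.smul_apply, smul_eq_mul] at h1
  have hxi : x i₀ = C * w i₀ := by rw [hC, div_mul_cancel₀ _ (hw i₀).ne']
  have h2 : s * (C * w i₀) ≤ r * (C * w i₀) := by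
    rw [hxi] at h1
    calc s * (C * w i₀) ≤ C * Matrix.vecMul w A i₀ := h1
      _ ≤ C * (r * w i₀) := mul_le_mul_of_nonneg_left (hwA i₀) hCpos.le
      _ = r * (C * w i₀) := by ring
  exact le_of_mul_le_mul_right h2 (mul_pos hCpos (hw i₀))

/-- Existence of a Perron–Frobenius eigenvector for a nonnegative matrix each of whose rows is
either zero or strictly positive. -/
theorem exists_pos_left_eigenvector (hrow : ∀ i, (∀ j, A i j = 0) ∨ (∀ j, 0 < A i j))
    (hne : ∃ i, ∀ j, 0 < A i j) :
    ∃ (r : ℝ) (w : ι → ℝ), 0 < r ∧ (∀ i, 0 < w i) ∧ Matrix.vecMul w A = r • w := by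
  classical
  obtain ⟨i₀, hi₀⟩ := hne
  have hA : ∀ i j, 0 ≤ A i j := fun i j =>
    (hrow i).elim (fun h => (h j).ge) (fun h => (h j).le)
  have hAcont : ∀ j, Continuous fun x : ι → ℝ => Matrix.vecMul x A j := by
    intro j
    simp only [Matrix.vecMul, dotProduct]
    fun_prop
  set C := ∑ j, ∑ i, A i j with hC
  have hbound : ∀ (x : ι → ℝ) (z : ℝ), x ∈ stdSimplex ℝ ι →
      (∀ j, z * x j ≤ Matrix.vecMul x A j) → z ≤ C := by
    intro x z hx hz
    have h1 : ∑ j, z * x j ≤ ∑ j, Matrix.vecMul x A j := Finset.sum_le_sum fun j _ => hz j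
    rw [← Finset.mul_sum, hx.2, mul_one] at h1
    refine h1.trans (Finset.sum_le_sum fun j _ => ?_)
    simp only [Matrix.vecMul, dotProduct]
    refine Finset.sum_le_sum fun i _ => ?_
    have : x i ≤ 1 := by
      rw [← hx.2]
      exact Finset.single_le_sum (fun i _ => hx.1 i) (Finset.mem_univ i)
    exact mul_le_of_le_one_left (hA i j) this
  -- Collatz–Wielandt: maximize `z` subject to `z x ≤ x A` over the simplex. The bound `C` serves
  -- only compactness, and the unit vector at the positive row `i₀` makes the maximum positive.
  set K : Set ((ι → ℝ) × ℝ) :=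
    (stdSimplex ℝ ι ×ˢ Set.Icc 0 C) ∩ {q | ∀ j, q.2 * q.1 j ≤ Matrix.vecMul q.1 A j} with hK
  have hKc : IsCompact K := by
    refine ((isCompact_stdSimplex ℝ ι).prod isCompact_Icc).inter_right ?_
    simp only [Set.ofPred_forall]
    refine isClosed_iInter fun j => isClosed_le (by fun_prop) ((hAcont j).comp continuous_fst)
  have hstart : ((Pi.single i₀ 1 : ι → ℝ), A i₀ i₀) ∈ K := by
    have hsub : ∀ j, A i₀ i₀ * (Pi.single i₀ 1 : ι → ℝ) j ≤
        Matrix.vecMul (Pi.single i₀ 1 : ι → ℝ) A j := by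
      intro j
      rw [Matrix.single_one_vecMul]
      by_cases hj : j = i₀
      · subst hj; simp
      · simpa [hj] using hA i₀ j
    exact ⟨⟨single_mem_stdSimplex ℝ i₀, (hi₀ i₀).le,
      hbound _ _ (single_mem_stdSimplex ℝ i₀) hsub⟩, hsub⟩
  obtain ⟨⟨x, r⟩, ⟨⟨hx, hr⟩, hxr⟩, hmax⟩ :=
    hKc.exists_isMaxOn ⟨_, hstart⟩ continuous_snd.continuousOn
  simp only [Set.mem_ofPred_eq] at hx hr hxr
  have hrpos : 0 < r := lt_of_lt_of_le (hi₀ i₀) (hmax hstart)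
  -- With zero rows the maximizer `x` need not be an eigenvector, but `y = x A` is. If the defect `v
  -- = y - r x` charged a positive row, `r y < y A` would hold strictly and `r` could be raised; so
  -- `v` sits on zero rows and `v A = 0`.
  set y := Matrix.vecMul x A with hy
  have hynn : ∀ j, 0 ≤ y j := Matrix.vecMul_entry_nonneg hA hx.1
  have hysum : 0 < ∑ j, y j := by
    have h1 : ∑ j, r * x j ≤ ∑ j, y j := Finset.sum_le_sum fun j _ => hxr j
    rw [← Finset.mul_sum, hx.2, mul_one] at h1
    linarith
  set v : ι → ℝ := fun j => y j - r * x j with hv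
  have hvnn : ∀ j, 0 ≤ v j := fun j => sub_nonneg.mpr (hxr j)
  have hvA : ∀ j, Matrix.vecMul y A j - r * y j = Matrix.vecMul v A j := by
    intro j
    have : v = y - r • x := rfl
    rw [this, Matrix.sub_vecMul, Matrix.smul_vecMul]
    rfl
  have hvz : ∀ i, (∀ j, 0 < A i j) → v i = 0 := by
    intro i hi
    by_contra hvi
    have hvpos : 0 < v i := lt_of_le_of_ne (hvnn i) (Ne.symm hvi)
    have hlt : ∀ j, r * y j < Matrix.vecMul y A j := by
      intro j
      have h1 : v i * A i j ≤ Matrix.vecMul v A j :=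
        Finset.single_le_sum (f := fun k => v k * A k j)
          (fun k _ => mul_nonneg (hvnn k) (hA k j)) (Finset.mem_univ i)
      linarith [hvA j, mul_pos hvpos (hi j)]
    obtain ⟨ε, hε, hεy⟩ := Pi.exists_forall_pos_add_lt hlt
    set Y := ∑ j, y j with hY
    have hyY : ∀ j, y j ≤ Y := fun j =>
      Finset.single_le_sum (fun i _ => hynn i) (Finset.mem_univ j)
    have hmem : Y⁻¹ • y ∈ stdSimplex ℝ ι := by
      refine ⟨fun j => by simpa using mul_nonneg (inv_nonneg.mpr hysum.le) (hynn j), ?_⟩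
      simp only [Pi.smul_apply, smul_eq_mul]
      rw [← Finset.mul_sum, inv_mul_cancel₀ hysum.ne']
    have hsub : ∀ j, (r + ε / Y) * (Y⁻¹ • y) j ≤ Matrix.vecMul (Y⁻¹ • y) A j := by
      intro j
      rw [Matrix.smul_vecMul, Pi.smul_apply, Pi.smul_apply, smul_eq_mul, smul_eq_mul]
      have h1 : ε / Y * y j ≤ ε := by
        rw [div_mul_eq_mul_div, div_le_iff₀ hysum]
        exact mul_le_mul_of_nonneg_left (hyY j) hε.le
      calc (r + ε / Y) * (Y⁻¹ * y j) = Y⁻¹ * (r * y j + ε / Y * y j) := by ring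
        _ ≤ Y⁻¹ * Matrix.vecMul y A j :=
          mul_le_mul_of_nonneg_left (by linarith [hεy j]) (inv_nonneg.mpr hysum.le)
    have hKmem : (Y⁻¹ • y, r + ε / Y) ∈ K :=
      ⟨⟨hmem, by have := div_pos hε hysum; linarith, hbound _ _ hmem hsub⟩, hsub⟩
    have h2 : r + ε / Y ≤ r := hmax hKmem
    have := div_pos hε hysum
    linarith
  have hvA0 : ∀ j, Matrix.vecMul v A j = 0 := by
    intro j
    simp only [Matrix.vecMul, dotProduct]
    refine Finset.sum_eq_zero fun i _ => ?_
    rcases hrow i with h | h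
    · rw [h j, mul_zero]
    · rw [hvz i h, zero_mul]
  have hyA : ∀ j, Matrix.vecMul y A j = r * y j := fun j => by
    have := hvA j
    rw [hvA0 j] at this
    linarith
  refine ⟨r, y, hrpos, fun j => ?_, funext fun j => hyA j⟩
  -- Mass only on zero rows would give `y A = 0`, against `y A = r y`. One charged positive row
  -- makes all of `y A` positive.
  obtain ⟨i, hi, hyi⟩ : ∃ i, (∀ j, 0 < A i j) ∧ 0 < y i := by
    by_contra hcon
    push Not at hcon
    have hz : ∀ j, y j = 0 := by
      intro j
      have h0 : Matrix.vecMul y A j = 0 := by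
        simp only [Matrix.vecMul, dotProduct]
        refine Finset.sum_eq_zero fun i _ => ?_
        rcases hrow i with h | h
        · rw [h j, mul_zero]
        · rw [le_antisymm (hcon i h) (hynn i), zero_mul]
      rw [hyA j] at h0
      exact (mul_eq_zero.mp h0).resolve_left hrpos.ne'
    rw [Finset.sum_eq_zero fun j _ => hz j] at hysum
    exact lt_irrefl _ hysum
  have h1 : y i * A i j ≤ Matrix.vecMul y A j :=
    Finset.single_le_sum (f := fun k => y k * A k j)
      (fun k _ => mul_nonneg (hynn k) (hA k j)) (Finset.mem_univ i)
  rw [hyA j] at h1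
  have h2 := mul_pos hyi (hi j)
  by_contra hyj
  have : r * y j ≤ 0 := mul_nonpos_of_nonneg_of_nonpos hrpos.le (not_lt.mp hyj)
  linarith

/-- By the triangle inequality the moduli of a complex left eigenvector form a subinvariant vector
for `‖z‖`, to be compared with `w`. -/
theorem norm_le_of_mem_spectrum [DecidableEq ι] (hA : ∀ i j, 0 ≤ A i j) {w : ι → ℝ} {r : ℝ}
    (hw : ∀ i, 0 < w i) (hwA : ∀ j, Matrix.vecMul w A j ≤ r * w j) {z : ℂ}
    (hz : z ∈ spectrum ℂ (A.map (algebraMap ℝ ℂ))) : ‖z‖ ≤ r := by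
  rw [spectrum.mem_iff, Matrix.isUnit_iff_isUnit_det, isUnit_iff_ne_zero, not_not,
    ← Matrix.exists_vecMul_eq_zero_iff] at hz
  obtain ⟨x, hx0, hx⟩ := hz
  have hxA : Matrix.vecMul x (A.map (algebraMap ℝ ℂ)) = z • x := by
    rw [Matrix.vecMul_sub, sub_eq_zero] at hx
    rw [← hx, Algebra.algebraMap_eq_smul_one, Matrix.vecMul_smul, Matrix.vecMul_one]
  refine le_of_subinvariant_of_superinvariant hA (x := fun i => ‖x i‖) (fun i => norm_nonneg _)
    ?_ ?_ hw hwA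
  · obtain ⟨i, hi⟩ := Function.ne_iff.mp hx0
    exact ⟨i, by simpa using hi⟩
  · intro j
    have h1 := congrFun hxA j
    simp only [Matrix.vecMul, dotProduct, Pi.smul_apply, smul_eq_mul, Matrix.map_apply] at h1 ⊢
    rw [← norm_mul, ← h1]
    refine (norm_sum_le _ _).trans (Finset.sum_le_sum fun i _ => ?_)
    rw [norm_mul]
    simp [abs_of_nonneg (hA i j)]

/-- A Jordan chain above `w` would supply `y` with `y A = r y + c w` and, after a sign change, `c >
0`. Adding a multiple of `w` makes `y` positive, hence subinvariant for some number above `r`, which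
is impossible. So the generalized eigenspace, whose dimension is the algebraic multiplicity, is the
line of `w`. -/
theorem rootMultiplicity_charpoly_eq_one [DecidableEq ι] [Nonempty ι] (hA : ∀ i j, 0 ≤ A i j)
    {w : ι → ℝ} {r : ℝ} (hw : ∀ i, 0 < w i) (hwA : Matrix.vecMul w A = r • w)
    (hgeo : ∀ x, Matrix.vecMul x A = r • x → ∃ c : ℝ, x = c • w) :
    A.charpoly.rootMultiplicity r = 1 := by
  have hno : ∀ (y : ι → ℝ) (c : ℝ), Matrix.vecMul y A = r • y + c • w → c ≤ 0 := by
    intro y c hy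
    by_contra hc
    rw [not_le] at hc
    obtain ⟨t, ht, hty⟩ := exists_pos_le_mul (x := y) hw
    set y' := y + (2 * t) • w with hy'
    have hy'pos : ∀ i, 0 < y' i := by
      intro i
      simp only [hy', Pi.add_apply, Pi.smul_apply, smul_eq_mul]
      have := mul_pos ht (hw i)
      linarith [neg_abs_le (y i), hty i]
    obtain ⟨C, hC, hCy⟩ := exists_pos_le_mul (x := y') hw
    have hy'A : Matrix.vecMul y' A = r • y' + c • w := by
      rw [hy', Matrix.add_vecMul, Matrix.smul_vecMul, hy, hwA, smul_add, smul_comm r]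
      abel
    have := le_of_subinvariant_of_superinvariant hA (x := y') (s := r + c / C) (r := r)
      (fun i => (hy'pos i).le) ⟨Classical.arbitrary ι, (hy'pos _).ne'⟩ (fun j => by
        rw [hy'A]
        simp only [Pi.add_apply, Pi.smul_apply, smul_eq_mul]
        have h1 := hCy j
        rw [abs_of_pos (hy'pos j)] at h1
        have h2 : c / C * y' j ≤ c * w j := by
          rw [div_mul_eq_mul_div, div_le_iff₀ hC, mul_assoc]
          refine mul_le_mul_of_nonneg_left ?_ hc.le
          linarith
        linarith) hw (fun j => by rw [hwA]; rfl)
    have := div_pos hc hC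
    linarith
  have hno' : ∀ (y : ι → ℝ) (c : ℝ), Matrix.vecMul y A = r • y + c • w → c = 0 := by
    intro y c hy
    refine le_antisymm (hno y c hy) ?_
    have h1 := hno (-y) (-c) (by rw [Matrix.neg_vecMul, hy]; module)
    linarith
  set f : Module.End ℝ (ι → ℝ) := Matrix.mulVecLin (A.transpose) with hf
  have hfx : ∀ x, f x = Matrix.vecMul x A := fun x => Matrix.mulVec_transpose A x
  have hch : f.charpoly = A.charpoly := by
    rw [hf, Matrix.charpoly_mulVecLin, Matrix.charpoly_transpose]
  rw [← hch, ← LinearMap.finrank_maxGenEigenspace_eq]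
  have hspan : f.maxGenEigenspace r = Submodule.span ℝ {w} := by
    have hind : ∀ (k : ℕ) (x : ι → ℝ), ((f - r • (1 : Module.End ℝ (ι → ℝ))) ^ k) x = 0 →
        ∃ c : ℝ, x = c • w := by
      intro k
      induction k with
      | zero => intro x hx; exact ⟨0, by simpa using hx⟩
      | succ k ih =>
        intro x hx
        rw [pow_succ, Module.End.mul_apply] at hx
        obtain ⟨c, hc⟩ := ih _ hx
        have h1 : Matrix.vecMul x A = r • x + c • w := by
          rw [← hc, ← hfx]
          simp
        have h2 := hno' x c h1
        rw [h2, zero_smul, add_zero] at h1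
        exact hgeo x h1
    ext x
    rw [Module.End.mem_maxGenEigenspace, Submodule.mem_span_singleton]
    constructor
    · rintro ⟨k, hk⟩
      obtain ⟨c, hc⟩ := hind k x hk
      exact ⟨c, hc.symm⟩
    · rintro ⟨c, rfl⟩
      refine ⟨1, ?_⟩
      rw [pow_one, LinearMap.sub_apply, hfx, Matrix.smul_vecMul, hwA]
      simp [smul_comm c]
  rw [hspan]
  refine finrank_span_singleton ?_
  intro h0
  have := hw (Classical.arbitrary ι)
  rw [h0] at this
  exact lt_irrefl _ this

/-- Geometric growth of `x Aᵏ` at the Perron–Frobenius rate. -/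
theorem exists_tendsto_sum_vecMul_pow_div [DecidableEq ι] [Nonempty ι] (hA : ∀ i j, 0 ≤ A i j)
    (hne : ∃ i, ∀ j, 0 < A i j) {w : ι → ℝ} {r : ℝ} (hr : 0 < r) (hw : ∀ i, 0 < w i)
    (hwA : Matrix.vecMul w A = r • w) {x : ι → ℝ} (hx : ∀ i, 0 < x i) :
    ∃ c : ℝ, 0 < c ∧
      Tendsto (fun k : ℕ => (∑ i, Matrix.vecMul x (A ^ k) i) / r ^ k) atTop (𝓝 c) := by
  obtain ⟨i₀, hi₀⟩ := hne
  -- Rescaling by `w` and `r` makes `A` column-stochastic, so each `q (k + 1) j` is an average of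
  -- the `q k i`, with weight at least `δ` on `i₀` (Doeblin's condition).
  set P : ι → ι → ℝ := fun i j => w i * A i j / (r * w j) with hP
  have hPnn : ∀ i j, 0 ≤ P i j := fun i j =>
    div_nonneg (mul_nonneg (hw i).le (hA i j)) (mul_pos hr (hw j)).le
  have hPsum : ∀ j, ∑ i, P i j = 1 := by
    intro j
    rw [hP, ← Finset.sum_div, div_eq_one_iff_eq (mul_pos hr (hw j)).ne']
    exact congrFun hwA j
  obtain ⟨j₀, hj₀⟩ := Finite.exists_min fun j => P i₀ j
  set δ := P i₀ j₀ with hδ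
  have hδpos : 0 < δ := div_pos (mul_pos (hw _) (hi₀ _)) (mul_pos hr (hw _))
  have hδle : δ ≤ 1 := by
    rw [← hPsum j₀]
    exact Finset.single_le_sum (f := fun i => P i j₀) (fun i _ => hPnn i j₀) (Finset.mem_univ i₀)
  set q : ℕ → ι → ℝ := fun k j => Matrix.vecMul x (A ^ k) j / (r ^ k * w j) with hq
  have hqs : ∀ k j, q (k + 1) j = ∑ i, P i j * q k i := by
    intro k j
    simp only [hq, hP]
    rw [pow_succ, ← Matrix.vecMul_vecMul]
    have hexp : Matrix.vecMul (Matrix.vecMul x (A ^ k)) A j =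
        ∑ i, Matrix.vecMul x (A ^ k) i * A i j := rfl
    rw [hexp, Finset.sum_div]
    refine Finset.sum_congr rfl fun i _ => ?_
    have h1 := (hw i).ne'
    have h2 := (hw j).ne'
    field_simp
    ring
  obtain ⟨j₁, hj₁⟩ := Finite.exists_min fun j => q 0 j
  obtain ⟨j₂, hj₂⟩ := Finite.exists_max fun j => q 0 j
  have hq0 : 0 < q 0 j₁ := by
    simp only [hq, pow_zero, Matrix.vecMul_one, one_mul]
    exact div_pos (hx _) (hw _)
  -- Lower and upper envelopes of `q k`, both drawn towards `q k i₀` by the fraction `δ`; their gap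
  -- shrinks by exactly `1 - δ` per step.
  let a : ℕ → ℝ := fun k => Nat.rec (q 0 j₁) (fun k a => a + δ * (q k i₀ - a)) k
  let b : ℕ → ℝ := fun k => Nat.rec (q 0 j₂) (fun k b => b - δ * (b - q k i₀)) k
  have has : ∀ k, a (k + 1) = a k + δ * (q k i₀ - a k) := fun k => rfl
  have hbs : ∀ k, b (k + 1) = b k - δ * (b k - q k i₀) := fun k => rfl
  have hab : ∀ k j, a k ≤ q k j ∧ q k j ≤ b k := by
    intro k
    induction k with
    | zero => exact fun j => ⟨hj₁ j, hj₂ j⟩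
    | succ k ih =>
      intro j
      have key : ∀ c : ℝ, q (k + 1) j - c = ∑ i, P i j * (q k i - c) := by
        intro c
        simp only [mul_sub, Finset.sum_sub_distrib, ← Finset.sum_mul]
        rw [hqs, hPsum, one_mul]
      have key' : ∀ c : ℝ, c - q (k + 1) j = ∑ i, P i j * (c - q k i) := by
        intro c
        simp only [mul_sub, Finset.sum_sub_distrib, ← Finset.sum_mul]
        rw [hqs, hPsum, one_mul]
      constructor
      · have h1 := Finset.single_le_sum (f := fun i => P i j * (q k i - a k))
          (fun i _ => mul_nonneg (hPnn i j) (sub_nonneg.mpr (ih i).1)) (Finset.mem_univ i₀)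
        rw [← key] at h1
        have h2 : δ * (q k i₀ - a k) ≤ P i₀ j * (q k i₀ - a k) :=
          mul_le_mul_of_nonneg_right (hj₀ j) (sub_nonneg.mpr (ih i₀).1)
        rw [has]
        linarith
      · have h1 := Finset.single_le_sum (f := fun i => P i j * (b k - q k i))
          (fun i _ => mul_nonneg (hPnn i j) (sub_nonneg.mpr (ih i).2)) (Finset.mem_univ i₀)
        rw [← key'] at h1
        have h2 : δ * (b k - q k i₀) ≤ P i₀ j * (b k - q k i₀) :=
          mul_le_mul_of_nonneg_right (hj₀ j) (sub_nonneg.mpr (ih i₀).2)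
        rw [hbs]
        linarith
  have hamono : Monotone a := monotone_nat_of_le_succ fun k => by
    rw [has]
    have := mul_nonneg hδpos.le (sub_nonneg.mpr (hab k i₀).1)
    linarith
  have hbanti : Antitone b := antitone_nat_of_succ_le fun k => by
    rw [hbs]
    have := mul_nonneg hδpos.le (sub_nonneg.mpr (hab k i₀).2)
    linarith
  have hgap : ∀ k, b k - a k = (1 - δ) ^ k * (b 0 - a 0) := by
    intro k
    induction k with
    | zero => simp
    | succ k ih =>
      rw [has, hbs, pow_succ]
      linear_combination (1 - δ) * ih
  have habdd : BddAbove (Set.range a) := by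
    refine ⟨b 0, ?_⟩
    rintro _ ⟨k, rfl⟩
    exact ((hab k i₀).1.trans (hab k i₀).2).trans (hbanti (Nat.zero_le k))
  have halim := tendsto_atTop_ciSup hamono habdd
  set l := ⨆ k, a k with hl
  have hlpos : 0 < l := lt_of_lt_of_le hq0 (hamono.ge_of_tendsto halim 0)
  have hgaplim : Tendsto (fun k => b k - a k) atTop (𝓝 0) := by
    rw [funext hgap]
    have := (tendsto_pow_atTop_nhds_zero_of_lt_one (sub_nonneg.mpr hδle)
      (by linarith : 1 - δ < 1)).mul_const (b 0 - a 0)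
    simpa using this
  have hblim : Tendsto b atTop (𝓝 l) := by
    have := hgaplim.add halim
    simpa using this
  have hqlim : ∀ j, Tendsto (fun k => q k j) atTop (𝓝 l) := fun j =>
    tendsto_of_tendsto_of_tendsto_of_le_of_le halim hblim (fun k => (hab k j).1)
      (fun k => (hab k j).2)
  refine ⟨∑ j, l * w j, Finset.sum_pos (fun j _ => mul_pos hlpos (hw j)) Finset.univ_nonempty, ?_⟩
  have hsum : ∀ k, (∑ i, Matrix.vecMul x (A ^ k) i) / r ^ k = ∑ j, q k j * w j := by
    intro k
    rw [Finset.sum_div]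
    refine Finset.sum_congr rfl fun j _ => ?_
    simp only [hq]
    have h1 := (hw j).ne'
    field_simp
  simp only [hsum]
  exact tendsto_finsetSum _ fun j _ => (hqlim j).mul_const _

end PerronFrobenius

/-! ### Row and column sums of the block generator -/

section Generator

variable {ι : Type}

theorem hasSum_level {f : ι → ℝ} {a : ℝ} (l : ℕ) (h : HasSum f a) :
    HasSum (fun y : ℕ × ι => if y.1 = l then f y.2 else 0) a := by
  have hinj : Function.Injective fun i : ι => (l, i) := fun i j hij => (Prod.ext_iff.mp hij).2
  rw [← hinj.hasSum_iff]
  · simpa [Function.comp_def] using h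
  · rintro ⟨k, i⟩ hk
    rw [if_neg]
    rintro rfl
    exact hk ⟨i, rfl⟩

variable {B : QBDBlocks ι}

theorem QBDBlocks.hasSum_generator_row {i : ι} {q₀ q₁ q₂ t : ℝ} (h0 : HasSum (B.Q0 i) q₀)
    (h1 : HasSum (B.Q1 i) q₁) (h2 : HasSum (B.Q2 i) q₂) (ht : HasSum (B.Qt1 i) t)
    (ht0 : q₀ + t = 0) (h012 : q₀ + q₁ + q₂ = 0) (k : ℕ) : HasSum (B.generator (k, i)) 0 := by
  cases k with
  | zero =>
    have h := (hasSum_level 1 h0).add (hasSum_level 0 ht)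
    rw [ht0] at h
    refine h.congr_fun ?_
    rintro ⟨l, j⟩
    simp only [QBDBlocks.generator]
    split_ifs <;> first | omega | contradiction | simp
  | succ k =>
    have h := ((hasSum_level (k + 2) h0).add (hasSum_level (k + 1) h1)).add (hasSum_level k h2)
    rw [h012] at h
    refine h.congr_fun ?_
    rintro ⟨l, j⟩
    simp only [QBDBlocks.generator]
    split_ifs <;> first | omega | contradiction | simp

theorem QBDBlocks.hasSum_generator_col_zero {p : ℕ × ι → ℝ} {j : ι} {a b : ℝ}
    (ht : HasSum (fun i => p (0, i) * B.Qt1 i j) a)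
    (h2 : HasSum (fun i => p (1, i) * B.Q2 i j) b) (hab : a + b = 0) :
    HasSum (fun x => p x * B.generator x (0, j)) 0 := by
  have h := (hasSum_level 0 ht).add (hasSum_level 1 h2)
  rw [hab] at h
  refine h.congr_fun ?_
  rintro ⟨l, i⟩
  rcases Nat.lt_or_ge l 2 with hl | hl
  · interval_cases l <;> simp [QBDBlocks.generator]
  · simp only [QBDBlocks.generator]
    split_ifs <;> first | omega | contradiction | simp

theorem QBDBlocks.hasSum_generator_col_succ {p : ℕ × ι → ℝ} {j : ι} {a b c : ℝ} {k : ℕ}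
    (h0 : HasSum (fun i => p (k, i) * B.Q0 i j) a)
    (h1 : HasSum (fun i => p (k + 1, i) * B.Q1 i j) b)
    (h2 : HasSum (fun i => p (k + 2, i) * B.Q2 i j) c) (habc : a + b + c = 0) :
    HasSum (fun x => p x * B.generator x (k + 1, j)) 0 := by
  have h := ((hasSum_level k h0).add (hasSum_level (k + 1) h1)).add (hasSum_level (k + 2) h2)
  rw [habc] at h
  refine h.congr_fun ?_
  rintro ⟨l, i⟩
  by_cases hl : l = k
  · subst hl; simp [QBDBlocks.generator]
  by_cases hl1 : l = k + 1
  · subst hl1; simp [QBDBlocks.generator]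
  by_cases hl2 : l = k + 2
  · subst hl2; simp [QBDBlocks.generator]
  simp only [QBDBlocks.generator]
  split_ifs <;> first | omega | contradiction | simp

end Generator

/-! ### The matrix-geometric stationary distribution -/

/-- A finite Metzler matrix with zero row sums has a nonzero nonnegative left null vector. -/
theorem exists_nonneg_left_null_vector {ι : Type} [Fintype ι] [Nonempty ι] {T : Matrix ι ι ℝ}
    (hoff : ∀ i j, i ≠ j → 0 ≤ T i j) (hrow : ∀ i, ∑ j, T i j = 0) :
    ∃ x : ι → ℝ, (∀ i, 0 ≤ x i) ∧ (∃ i, x i ≠ 0) ∧ Matrix.vecMul x T = 0 := by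
  classical
  -- The constants are a right null vector, so a left null vector `v` exists. Then `|v| T` is
  -- nonnegative with total zero.
  have hdet : T.det = 0 := by
    rw [← Matrix.exists_mulVec_eq_zero_iff]
    refine ⟨fun _ => 1, ?_, ?_⟩
    · intro h
      exact one_ne_zero (congrFun h (Classical.arbitrary ι))
    · funext i
      simpa [Matrix.mulVec, dotProduct] using hrow i
  obtain ⟨v, hv0, hv⟩ := Matrix.exists_vecMul_eq_zero_iff.mpr hdet
  obtain ⟨i, hi⟩ := Function.ne_iff.mp hv0
  refine ⟨fun i => |v i|, fun i => abs_nonneg _, ⟨i, by simpa using hi⟩, ?_⟩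
  have hnn : ∀ j, 0 ≤ Matrix.vecMul (fun i => |v i|) T j := by
    intro j
    obtain ⟨ε, hε, hεv⟩ : ∃ ε : ℝ, |ε| = 1 ∧ ε * v j = |v j| := by
      rcases le_total 0 (v j) with h | h
      · exact ⟨1, by simp, by rw [abs_of_nonneg h, one_mul]⟩
      · exact ⟨-1, by simp, by rw [abs_of_nonpos h]; ring⟩
    have h1 : ∑ i, ε * (v i * T i j) = 0 := by
      rw [← Finset.mul_sum]
      have : ∑ i, v i * T i j = 0 := congrFun hv j
      rw [this, mul_zero]
    rw [← h1]
    simp only [Matrix.vecMul, dotProduct]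
    refine Finset.sum_le_sum fun i _ => ?_
    rw [← mul_assoc]
    by_cases hij : i = j
    · rw [hij, hεv]
    · refine mul_le_mul_of_nonneg_right ?_ (hoff i j hij)
      calc ε * v i ≤ |ε * v i| := le_abs_self _
        _ = |v i| := by rw [abs_mul, hε, one_mul]
  have hsum : ∑ j, Matrix.vecMul (fun i => |v i|) T j = 0 := by
    simp only [Matrix.vecMul, dotProduct]
    rw [Finset.sum_comm]
    refine Finset.sum_eq_zero fun i _ => ?_
    rw [← Finset.mul_sum, hrow, mul_zero]
  funext j
  exact (Finset.sum_eq_zero_iff_of_nonneg fun j _ => hnn j).mp hsum j (Finset.mem_univ j)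

/-- In a matrix-geometric solution with spectral radius below one, the drift across each level
boundary vanishes: `Q₀ 1 = μ R 1`. -/
theorem QBDBlocks.rowSum_Q0_eq {ι : Type} [Fintype ι] [DecidableEq ι] {B : QBDBlocks ι} {μ : ℝ}
    (hQ2 : B.Q2 = μ • (1 : Matrix ι ι ℝ)) {R : Matrix ι ι ℝ} (hR : ∀ i j, 0 ≤ R i j)
    (heq : B.Q0 + R * B.Q1 + R * R * B.Q2 = 0) {w : ι → ℝ} {r : ℝ} (hw : ∀ i, 0 < w i)
    (hr1 : r < 1) (hwR : Matrix.vecMul w R = r • w)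
    (hrow : ∀ i, ∑ j, B.Q0 i j + ∑ j, B.Q1 i j + ∑ j, B.Q2 i j = 0) (i : ι) :
    ∑ j, B.Q0 i j = μ * ∑ j, R i j := by
  set e : ι → ℝ := fun _ => 1 with he
  have hsum : ∀ M : Matrix ι ι ℝ, ∀ i, Matrix.mulVec M e i = ∑ j, M i j := by
    intro M i
    simp [Matrix.mulVec, dotProduct, he]
  -- Applying the matrix equation to `e` and inserting `Q₁ e = -Q₀ e - μ e` shows `x = R x`. Pairing
  -- `|x| ≤ R |x|` with `w` gives `w·|x| ≤ r w·|x|`, and `r < 1` forces `x = 0`.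
  set x : ι → ℝ := Matrix.mulVec B.Q0 e - μ • Matrix.mulVec R e with hx
  have hQ1e : Matrix.mulVec B.Q1 e = -Matrix.mulVec B.Q0 e - μ • e := by
    have h : Matrix.mulVec B.Q0 e + Matrix.mulVec B.Q1 e + Matrix.mulVec B.Q2 e = 0 := by
      funext i
      simp only [Pi.add_apply, hsum]
      exact hrow i
    rw [hQ2, Matrix.smul_mulVec, Matrix.one_mulVec] at h
    linear_combination h
  have hfix : x = Matrix.mulVec R x := by
    have h : Matrix.mulVec (B.Q0 + R * B.Q1 + R * R * B.Q2) e = 0 := by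
      rw [heq, Matrix.zero_mulVec]
    rw [Matrix.add_mulVec, Matrix.add_mulVec, ← Matrix.mulVec_mulVec, hQ1e, hQ2, Matrix.mul_smul,
      Matrix.mul_one, Matrix.smul_mulVec, ← Matrix.mulVec_mulVec, Matrix.mulVec_sub,
      Matrix.mulVec_neg, Matrix.mulVec_smul] at h
    rw [hx, Matrix.mulVec_sub, Matrix.mulVec_smul]
    linear_combination h
  have habs : ∀ i, |x i| ≤ Matrix.mulVec R (fun i => |x i|) i := by
    intro i
    have h1 : x i = ∑ j, R i j * x j := congrFun hfix i
    rw [h1]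
    refine (Finset.abs_sum_le_sum_abs _ _).trans (Finset.sum_le_sum fun j _ => ?_)
    rw [abs_mul, abs_of_nonneg (hR i j)]
  have h1 : dotProduct w (fun i => |x i|) ≤ r * dotProduct w (fun i => |x i|) := by
    calc dotProduct w (fun i => |x i|) ≤ dotProduct w (Matrix.mulVec R (fun i => |x i|)) :=
          Finset.sum_le_sum fun i _ => mul_le_mul_of_nonneg_left (habs i) (hw i).le
      _ = r * dotProduct w (fun i => |x i|) := by
          rw [Matrix.dotProduct_mulVec, hwR, smul_dotProduct, smul_eq_mul]
  have hnn : ∀ i, 0 ≤ w i * |x i| := fun i => mul_nonneg (hw i).le (abs_nonneg _)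
  have h0 : dotProduct w (fun i => |x i|) = 0 := by
    have : 0 ≤ dotProduct w (fun i => |x i|) := Finset.sum_nonneg fun i _ => hnn i
    nlinarith
  have h2 := (Finset.sum_eq_zero_iff_of_nonneg fun i _ => hnn i).mp h0 i (Finset.mem_univ i)
  have h3 : x i = 0 := abs_eq_zero.mp ((mul_eq_zero.mp h2).resolve_left (hw i).ne')
  rw [hx, Pi.sub_apply, Pi.smul_apply, hsum, hsum, smul_eq_mul] at h3
  linarith

/-- The matrix-geometric stationary distribution `pₖ = p₀ Rᵏ` and its decay rate. -/
theorem QBDBlocks.hasStationaryDecayRate_of_neutsMatrix {ι : Type} [Fintype ι] [DecidableEq ι]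
    [Nonempty ι] {B : QBDBlocks ι} (hG : IsBoundedIrreducibleGenerator B.generator) {μ : ℝ}
    (hμ : 0 ≤ μ) (hQ2 : B.Q2 = μ • (1 : Matrix ι ι ℝ))
    (hoff : ∀ i j, i ≠ j → 0 ≤ B.Qt1 i j)
    (hrow : ∀ i, ∑ j, B.Q0 i j + ∑ j, B.Q1 i j + ∑ j, B.Q2 i j = 0)
    (hrowt : ∀ i, ∑ j, B.Q0 i j + ∑ j, B.Qt1 i j = 0)
    {R : Matrix ι ι ℝ} (hR : ∀ i j, 0 ≤ R i j) (heq : B.Q0 + R * B.Q1 + R * R * B.Q2 = 0)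
    (hne : ∃ i, ∀ j, 0 < R i j) {w : ι → ℝ} {r : ℝ} (hw : ∀ i, 0 < w i) (hr : 0 < r) (hr1 : r < 1)
    (hwR : Matrix.vecMul w R = r • w) : B.HasStationaryDecayRate r := by
  have hdrift := QBDBlocks.rowSum_Q0_eq hQ2 hR heq hw hr1 hwR hrow
  -- Balance at level `0` for `pₖ = x Rᵏ` reads `x (Q̃₁ + μ R) = 0`; the drift identity makes the
  -- row sums of this matrix zero.
  obtain ⟨x, hxnn, ⟨i₁, hi₁⟩, hxT⟩ := exists_nonneg_left_null_vector (T := B.Qt1 + μ • R)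
    (fun i j hij => add_nonneg (hoff i j hij) (mul_nonneg hμ (hR i j)))
    (fun i => by
      simp only [Matrix.add_apply, Matrix.smul_apply, smul_eq_mul]
      rw [Finset.sum_add_distrib, ← Finset.mul_sum, ← hdrift i]
      linarith [hrowt i])
  set u : ℕ × ι → ℝ := fun y => Matrix.vecMul x (R ^ y.1) y.2 with hu
  have hpow : ∀ k i j, 0 ≤ (R ^ k) i j := by
    intro k
    induction k with
    | zero => intro i j; rw [pow_zero, Matrix.one_apply]; split_ifs <;> norm_num
    | succ k ih => rw [pow_succ]; exact Matrix.mul_entry_nonneg ih hR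
  have hunn : ∀ y, 0 ≤ u y := fun y => Matrix.vecMul_entry_nonneg (hpow y.1) hxnn y.2
  have hubal : ∀ y, HasSum (fun z => u z * B.generator z y) 0 := by
    have hmul : ∀ (k : ℕ) (M : Matrix ι ι ℝ) (j : ι),
        HasSum (fun i => u (k, i) * M i j) (Matrix.vecMul x (R ^ k * M) j) := by
      intro k M j
      rw [← Matrix.vecMul_vecMul]
      exact hasSum_fintype _
    rintro ⟨k, j⟩
    cases k with
    | zero =>
      refine QBDBlocks.hasSum_generator_col_zero (hmul 0 _ j) (hmul 1 _ j) ?_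
      rw [← Pi.add_apply, ← Matrix.vecMul_add, hQ2, pow_zero, one_mul, pow_one, Matrix.mul_smul,
        mul_one, hxT]
      rfl
    | succ k =>
      refine QBDBlocks.hasSum_generator_col_succ (hmul k _ j) (hmul (k + 1) _ j)
        (hmul (k + 2) _ j) ?_
      rw [← Pi.add_apply, ← Pi.add_apply, ← Matrix.vecMul_add, ← Matrix.vecMul_add]
      have : R ^ k * B.Q0 + R ^ (k + 1) * B.Q1 + R ^ (k + 2) * B.Q2 =
          R ^ k * (B.Q0 + R * B.Q1 + R * R * B.Q2) := by
        rw [pow_add, pow_add, pow_one, pow_two]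
        simp only [mul_add, mul_assoc]
      rw [this, heq, mul_zero, Matrix.vecMul_zero]
      rfl
  -- Strict positivity of `x` comes from irreducibility of the whole chain, not of the matrix at
  -- level `0`.
  have hupos : ∀ y, 0 < u y := by
    refine (hG.invariant_pos_or_zero hunn hubal).resolve_right fun h => hi₁ ?_
    simpa [hu] using h (0, i₁)
  have hxpos : ∀ i, 0 < x i := fun i => by simpa [hu] using hupos (0, i)
  obtain ⟨C, hC, hxC⟩ := exists_pos_le_mul (x := x) hw
  have hule : ∀ y : ℕ × ι, u y ≤ r ^ y.1 * (C * w y.2) := by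
    rintro ⟨k, i⟩
    simp only [hu]
    induction k generalizing i with
    | zero => simpa using (le_abs_self _).trans (hxC i)
    | succ k ih =>
      rw [pow_succ, ← Matrix.vecMul_vecMul]
      have h1 := Matrix.vecMul_mono hR (v' := (r ^ k * C) • w) (fun i => by
        simpa [mul_assoc] using ih i) i
      rw [Matrix.smul_vecMul, hwR] at h1
      simp only [Pi.smul_apply, smul_eq_mul] at h1
      calc _ ≤ _ := h1
        _ = _ := by ring
  have husum : Summable u := by
    refine Summable.of_nonneg_of_le hunn hule ?_
    exact (summable_geometric_of_lt_one hr.le hr1).mul_of_nonneg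
      (f := fun k => r ^ k) (g := fun i => C * w i) (Summable.of_finite)
      (fun k => pow_nonneg hr.le k) (fun i => mul_nonneg hC.le (hw i).le)
  set N := ∑' y, u y with hN
  have hNpos : 0 < N := husum.tsum_pos hunn (0, i₁) (hupos _)
  have hstat : IsStationaryDistribution B.generator (fun y => N⁻¹ * u y) := by
    refine ⟨fun y => mul_nonneg (inv_nonneg.mpr hNpos.le) (hunn y), ?_, fun y => ?_⟩
    · have := husum.hasSum.mul_left N⁻¹
      rwa [← hN, inv_mul_cancel₀ hNpos.ne'] at this
    · simpa [mul_assoc] using (hubal y).mul_left N⁻¹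
  refine ⟨_, hstat, fun p' hp' => hG.stationary_unique hstat hp', hr, ?_⟩
  obtain ⟨c, hc, hlim⟩ := exists_tendsto_sum_vecMul_pow_div hR hne hr hw hwR hxpos
  refine ⟨N⁻¹ * c, mul_pos (inv_pos.mpr hNpos) hc, ?_⟩
  refine (hlim.const_mul N⁻¹).congr fun k => ?_
  rw [levelMarginal, tsum_fintype, ← Finset.mul_sum, mul_div_assoc]

/-! ### The tandem generator for finite and infinite capacity -/

/-- `φ` enumerates the phases `0, 1, …` up to the capacity `cap` without repetition. -/
structure IsPhaseEnumeration (cap : ℕ∞) {ι : Type} (φ : ι → ℕ) : Prop where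
  injective : Function.Injective φ
  le_cap_iff : ∀ n : ℕ, (n : ℕ∞) ≤ cap ↔ ∃ i, φ i = n

theorem isPhaseEnumeration_fin (m : ℕ) :
    IsPhaseEnumeration (m : ℕ∞) fun i : Fin (m + 1) => (i : ℕ) where
  injective := Fin.val_injective
  le_cap_iff n := by
    rw [Nat.cast_le]
    exact ⟨fun h => ⟨⟨n, Nat.lt_succ_of_le h⟩, rfl⟩, fun ⟨i, hi⟩ => hi ▸ Nat.lt_succ_iff.mp i.2⟩

theorem isPhaseEnumeration_nat : IsPhaseEnumeration ⊤ fun i : ℕ => i where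
  injective := Function.injective_id
  le_cap_iff n := ⟨fun _ => ⟨n, rfl⟩, fun _ => le_top⟩

theorem natCast_lt_iff_succ_le (n : ℕ) (cap : ℕ∞) : (n : ℕ∞) < cap ↔ ((n + 1 : ℕ) : ℕ∞) ≤ cap := by
  rw [Nat.cast_add, Nat.cast_one, ENat.add_one_le_iff (ENat.natCast_ne_top n)]

section Tandem

variable {ι : Type} {cap : ℕ∞} {φ : ι → ℕ} {lam μ₁ μ₂ : ℝ}

namespace IsPhaseEnumeration

theorem hasSum_ite (hφ : IsPhaseEnumeration cap φ) (n : ℕ) (c : ℝ) :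
    HasSum (fun i => if φ i = n then c else 0) (if (n : ℕ∞) ≤ cap then c else 0) := by
  by_cases hn : (n : ℕ∞) ≤ cap
  · obtain ⟨i, hi⟩ := (hφ.le_cap_iff n).mp hn
    rw [if_pos hn]
    have h := hasSum_single (f := fun i => if φ i = n then c else 0) i (fun j hj => by
      rw [if_neg]
      intro hjn
      exact hj (hφ.injective (hjn.trans hi.symm)))
    simpa [hi] using h
  · rw [if_neg hn]
    exact hasSum_zero.congr_fun fun i => if_neg fun hi => hn ((hφ.le_cap_iff n).mpr ⟨i, hi⟩)

theorem le_cap (hφ : IsPhaseEnumeration cap φ) (i : ι) : (φ i : ℕ∞) ≤ cap :=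
  (hφ.le_cap_iff _).mpr ⟨i, rfl⟩

theorem hasSum_ite_self (hφ : IsPhaseEnumeration cap φ) (i : ι) (c : ℝ) :
    HasSum (fun j => if φ j = φ i then c else 0) c := by
  have h := hφ.hasSum_ite (φ i) c
  rwa [if_pos (hφ.le_cap i)] at h

theorem hasSum_down_row (hφ : IsPhaseEnumeration cap φ) (i : ι) (c : ℝ) :
    HasSum (fun j => if φ i = φ j + 1 then c else 0) (if 0 < φ i then c else 0) := by
  rcases Nat.eq_zero_or_pos (φ i) with h0 | h0
  · rw [if_neg h0.not_gt]
    exact hasSum_zero.congr_fun fun j => if_neg (by omega)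
  · have h := hφ.hasSum_ite (φ i - 1) c
    have hle : ((φ i - 1 : ℕ) : ℕ∞) ≤ cap :=
      le_trans (Nat.cast_le.mpr (Nat.sub_le _ _)) (hφ.le_cap i)
    rw [if_pos hle] at h
    rw [if_pos h0]
    refine h.congr_fun fun j => ?_
    congr 1
    exact propext (by omega)

theorem hasSum_up_row (hφ : IsPhaseEnumeration cap φ) (i : ι) (c d : ℝ) :
    HasSum (fun j => if φ j = φ i + 1 then c else if φ j = φ i then d else 0)
      ((if (φ i : ℕ∞) < cap then c else 0) + d) := by
  have h := (hφ.hasSum_ite (φ i + 1) c).add (hφ.hasSum_ite_self i d)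
  simp only [natCast_lt_iff_succ_le]
  refine h.congr_fun fun j => ?_
  split_ifs <;> first | omega | simp

theorem hasSum_down_col (hφ : IsPhaseEnumeration cap φ) (X : ℕ → ℝ) (j : ι) (c : ℝ) :
    HasSum (fun i => X (φ i) * if φ i = φ j + 1 then c else 0)
      (if (φ j : ℕ∞) < cap then X (φ j + 1) * c else 0) := by
  simp only [natCast_lt_iff_succ_le]
  refine (hφ.hasSum_ite (φ j + 1) (X (φ j + 1) * c)).congr_fun fun i => ?_
  split_ifs with h
  · rw [h]
  · rw [mul_zero]

theorem hasSum_up_col (hφ : IsPhaseEnumeration cap φ) (X : ℕ → ℝ) (j : ι) (c : ℝ) (d : ι → ℝ) :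
    HasSum (fun i => X (φ i) * if φ j = φ i + 1 then c else if φ j = φ i then d i else 0)
      ((if 0 < φ j then X (φ j - 1) * c else 0) + X (φ j) * d j) := by
  have h := (hφ.hasSum_down_row j (X (φ j - 1) * c)).add (hφ.hasSum_ite_self j (X (φ j) * d j))
  refine h.congr_fun fun i => ?_
  by_cases h1 : φ j = φ i + 1
  · have h2 : φ i ≠ φ j := by omega
    have h3 : φ j - 1 = φ i := by omega
    rw [if_pos h1, if_pos h1, if_neg h2, h3, add_zero]
  · rw [if_neg h1, if_neg h1, zero_add]
    by_cases h2 : φ i = φ j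
    · rw [if_pos h2.symm, if_pos h2, hφ.injective h2]
    · rw [if_neg h2, if_neg (Ne.symm h2), mul_zero]

theorem hasSum_diag_col (hφ : IsPhaseEnumeration cap φ) (X : ℕ → ℝ) (j : ι) (c : ℝ) :
    HasSum (fun i => X (φ i) * if φ j = φ i then c else 0) (X (φ j) * c) := by
  refine (hφ.hasSum_ite_self j (X (φ j) * c)).congr_fun fun i => ?_
  by_cases h : φ i = φ j
  · rw [if_pos h.symm, if_pos h, h]
  · rw [if_neg h, if_neg (Ne.symm h), mul_zero]

theorem hasSum_diag_row (hφ : IsPhaseEnumeration cap φ) (i : ι) (c : ℝ) :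
    HasSum (fun j => if φ j = φ i then c else 0) c :=
  hφ.hasSum_ite_self i c

end IsPhaseEnumeration

theorem tandemBlocks_hasSum_generator_row (hφ : IsPhaseEnumeration cap φ) (x : ℕ × ι) :
    HasSum ((tandemBlocks lam μ₁ μ₂ cap φ).generator x) 0 := by
  obtain ⟨k, i⟩ := x
  set B := tandemBlocks lam μ₁ μ₂ cap φ with hB
  have h0 : HasSum (B.Q0 i) (if 0 < φ i then μ₁ else 0) := hφ.hasSum_down_row i μ₁
  have h2 : HasSum (B.Q2 i) μ₂ := hφ.hasSum_diag_row i μ₂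
  have h1 : HasSum (B.Q1 i) ((if (φ i : ℕ∞) < cap then lam else 0) +
      -((if (φ i : ℕ∞) < cap then lam else 0) + (if 0 < φ i then μ₁ else 0) + μ₂)) :=
    hφ.hasSum_up_row i lam _
  have ht : HasSum (B.Qt1 i) ((if (φ i : ℕ∞) < cap then lam else 0) +
      -((if (φ i : ℕ∞) < cap then lam else 0) + (if 0 < φ i then μ₁ else 0))) :=
    hφ.hasSum_up_row i lam _
  exact QBDBlocks.hasSum_generator_row h0 h1 h2 ht (by ring) (by ring) k

theorem tandemBlocks_generator_nonneg (hlam : 0 ≤ lam) (h₁ : 0 ≤ μ₁) (h₂ : 0 ≤ μ₂)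
    (hφ : Function.Injective φ) (x y : ℕ × ι) (hxy : x ≠ y) :
    0 ≤ (tandemBlocks lam μ₁ μ₂ cap φ).generator x y := by
  obtain ⟨k, i⟩ := x
  obtain ⟨l, j⟩ := y
  have hne : l = k → φ j ≠ φ i := fun hl hj => hxy (by rw [hl, hφ hj])
  have hdiag : ∀ c d : ℝ, 0 ≤ c → l = k →
      0 ≤ if φ j = φ i + 1 then c else if φ j = φ i then d else 0 := by
    intro c d hc hl
    rw [if_neg (hne hl)]
    split_ifs <;> first | assumption | exact le_rfl
  have hsame : l = k → 0 ≤ (tandemBlocks lam μ₁ μ₂ cap φ).Qt1 i j ∧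
      0 ≤ (tandemBlocks lam μ₁ μ₂ cap φ).Q1 i j := fun hl =>
    ⟨hdiag _ _ hlam hl, hdiag _ _ hlam hl⟩
  have hQ0 : 0 ≤ (tandemBlocks lam μ₁ μ₂ cap φ).Q0 i j := by
    simp only [tandemBlocks]
    split_ifs <;> first | assumption | exact le_rfl
  have hQ2 : 0 ≤ (tandemBlocks lam μ₁ μ₂ cap φ).Q2 i j := by
    simp only [tandemBlocks]
    split_ifs <;> first | assumption | exact le_rfl
  simp only [QBDBlocks.generator]
  split_ifs with a b <;> first
    | exact hQ0
    | exact (hsame b).1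
    | exact (hsame b).2
    | exact hQ2
    | exact le_rfl

/-- Every state leads to the empty network: clear the second queue, then pass the customers of the
first queue through it one at a time. From there, one arrival followed by a service at the first
queue raises the level by one, and further arrivals reach any phase. Capacity at least one is what
makes the level rise. -/
theorem tandemBlocks_generator_irreducible (hlam : 0 < lam) (h₁ : 0 < μ₁) (h₂ : 0 < μ₂)
    (hφ : IsPhaseEnumeration cap φ) (hcap : 1 ≤ cap) (U : Set (ℕ × ι)) (hU : U.Nonempty)
    (hcl : IsTransitionClosed (tandemBlocks lam μ₁ μ₂ cap φ).generator U) : U = Set.univ := by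
  have hdown : ∀ k i, (k + 1, i) ∈ U → (k, i) ∈ U := fun k i h =>
    hcl _ h _ (by simp) (by
      have : k ≠ k + 1 + 1 := by omega
      simp [QBDBlocks.generator, tandemBlocks, h₂, this])
  have hup : ∀ k i j, φ i = φ j + 1 → (k, i) ∈ U → (k + 1, j) ∈ U := fun k i j hij h =>
    hcl _ h _ (by simp) (by simp [QBDBlocks.generator, tandemBlocks, hij, h₁])
  have hright : ∀ k i j, φ j = φ i + 1 → (k, i) ∈ U → (k, j) ∈ U := fun k i j hij h =>
    hcl _ h _ (by
      intro h'
      have h2 : i = j := (Prod.ext_iff.mp h').2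
      rw [h2] at hij
      omega) (by
      simp only [QBDBlocks.generator, tandemBlocks, hij]
      simp [hlam])
  obtain ⟨z, hz⟩ := (hφ.le_cap_iff 0).mp (by simp)
  have hbottom : ∀ k i, (k, i) ∈ U → (0, i) ∈ U := by
    intro k
    induction k with
    | zero => exact fun i h => h
    | succ k ih => exact fun i h => ih i (hdown k i h)
  have hempty : ∀ n i, φ i = n → (0, i) ∈ U → (0, z) ∈ U := by
    intro n
    induction n with
    | zero => intro i hi h; rwa [← hφ.injective (hi.trans hz.symm)]
    | succ n ih =>
      intro i hi h
      obtain ⟨j, hj⟩ := (hφ.le_cap_iff n).mp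
        (le_trans (Nat.cast_le.mpr (by omega)) (hφ.le_cap i))
      exact ih j hj (hdown 0 j (hup 0 i j (by omega) h))
  have hfill : ∀ k, (k, z) ∈ U → ∀ n i, φ i = n → (k, i) ∈ U := by
    intro k hk n
    induction n with
    | zero => intro i hi; rwa [hφ.injective (hi.trans hz.symm)]
    | succ n ih =>
      intro i hi
      obtain ⟨j, hj⟩ := (hφ.le_cap_iff n).mp
        (le_trans (Nat.cast_le.mpr (by omega)) (hφ.le_cap i))
      exact hright k j i (by omega) (ih j hj)
  have h00 : (0, z) ∈ U := by
    obtain ⟨⟨k, i⟩, hki⟩ := hU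
    exact hempty _ i rfl (hbottom k i hki)
  have hlevels : ∀ k, (k, z) ∈ U := by
    intro k
    induction k with
    | zero => exact h00
    | succ k ih =>
      obtain ⟨o, ho⟩ := (hφ.le_cap_iff 1).mp (by simpa using hcap)
      exact hup k o z (by omega) (hfill k ih 1 o ho)
  refine Set.eq_univ_of_forall ?_
  rintro ⟨k, i⟩
  exact hfill k (hlevels k) _ i rfl

theorem tandemBlocks_isBoundedIrreducibleGenerator (hlam : 0 < lam) (h₁ : 0 < μ₁) (h₂ : 0 < μ₂)
    (hφ : IsPhaseEnumeration cap φ) (hcap : 1 ≤ cap) :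
    IsBoundedIrreducibleGenerator (tandemBlocks lam μ₁ μ₂ cap φ).generator where
  offDiag_nonneg := tandemBlocks_generator_nonneg hlam.le h₁.le h₂.le hφ.injective
  row_sum := tandemBlocks_hasSum_generator_row hφ
  bounded := by
    refine ⟨lam + μ₁ + μ₂, ?_⟩
    rintro ⟨k, i⟩
    simp only [QBDBlocks.generator, tandemBlocks]
    rw [abs_le]
    split_ifs <;> first | omega | (constructor <;> linarith)
  irreducible := tandemBlocks_generator_irreducible hlam h₁ h₂ hφ hcap

/-- The Jackson product form solves the tandem network with unlimited first queue. -/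
theorem infiniteTandem_hasStationaryDecayRate (hlam : 0 < lam) (h₁ : lam < μ₁) (h₂ : lam < μ₂) :
    (infiniteTandem lam μ₁ μ₂).HasStationaryDecayRate (lam / μ₂) := by
  have hμ₁ : 0 < μ₁ := hlam.trans h₁
  have hμ₂ : 0 < μ₂ := hlam.trans h₂
  have hφ := isPhaseEnumeration_nat
  have hG := tandemBlocks_isBoundedIrreducibleGenerator hlam hμ₁ hμ₂ hφ le_top
  set a := lam / μ₁ with ha
  set b := lam / μ₂ with hb
  have ha0 : 0 < a := div_pos hlam hμ₁
  have hb0 : 0 < b := div_pos hlam hμ₂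
  have ha1 : a < 1 := (div_lt_one hμ₁).mpr h₁
  have hb1 : b < 1 := (div_lt_one hμ₂).mpr h₂
  have haμ : a * μ₁ = lam := div_mul_cancel₀ _ hμ₁.ne'
  have hbμ : b * μ₂ = lam := div_mul_cancel₀ _ hμ₂.ne'
  have hgeo : ∀ c : ℝ, 0 < c → c < 1 → HasSum (fun n : ℕ => (1 - c) * c ^ n) 1 := by
    intro c hc0 hc1
    have h := (hasSum_geometric_of_lt_one hc0.le hc1).mul_left (1 - c)
    rwa [mul_inv_cancel₀ (sub_pos.mpr hc1).ne'] at h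
  have hX : ∀ k, HasSum (fun i : ℕ => (1 - b) * b ^ k * ((1 - a) * a ^ i)) ((1 - b) * b ^ k) := by
    intro k
    simpa using (hgeo a ha0 ha1).mul_left ((1 - b) * b ^ k)
  set p : ℕ × ℕ → ℝ := fun y => (1 - b) * b ^ y.1 * ((1 - a) * a ^ y.2) with hp
  have hpnn : ∀ y, 0 ≤ p y := fun y => by
    have h1 := sub_pos.mpr ha1
    have h2 := sub_pos.mpr hb1
    simp only [hp]
    positivity
  have hstat : IsStationaryDistribution (infiniteTandem lam μ₁ μ₂).generator p := by
    refine ⟨hpnn, ?_, ?_⟩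
    · have hs : Summable p := (hgeo b hb0 hb1).summable.mul_of_nonneg (hgeo a ha0 ha1).summable
        (fun k => mul_nonneg (sub_pos.mpr hb1).le (pow_nonneg hb0.le k))
        (fun k => mul_nonneg (sub_pos.mpr ha1).le (pow_nonneg ha0.le k))
      have h := hs.hasSum.prod_fiberwise hX
      rw [← h.unique (hgeo b hb0 hb1)]
      exact hs.hasSum
    · rintro ⟨k, j⟩
      cases k with
      | zero =>
        refine QBDBlocks.hasSum_generator_col_zero
          (hφ.hasSum_up_col (fun i => (1 - b) * b ^ 0 * ((1 - a) * a ^ i)) j lam _)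
          (hφ.hasSum_diag_col (fun i => (1 - b) * b ^ 1 * ((1 - a) * a ^ i)) j μ₂) ?_
        rcases j with _ | j
        · simp
          rw [← hbμ]; ring
        · simp [pow_succ]
          rw [← hbμ] at haμ ⊢
          linear_combination (-(1 - b) * (1 - a) * a ^ j) * haμ
      | succ k =>
        refine QBDBlocks.hasSum_generator_col_succ
          (hφ.hasSum_down_col (fun i => (1 - b) * b ^ k * ((1 - a) * a ^ i)) j μ₁)
          (hφ.hasSum_up_col (fun i => (1 - b) * b ^ (k + 1) * ((1 - a) * a ^ i)) j lam _)
          (hφ.hasSum_diag_col (fun i => (1 - b) * b ^ (k + 2) * ((1 - a) * a ^ i)) j μ₂) ?_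
        rcases j with _ | j
        · simp [pow_succ]
          linear_combination ((1 - b) * b ^ k * (1 - a)) * (haμ - hbμ + b * hbμ)
        · simp [pow_succ]
          linear_combination ((1 - b) * b ^ k * (1 - a) * a ^ j) *
            (a * haμ - a * hbμ + a * b * hbμ - b * haμ)
  have hmarg : ∀ k, levelMarginal p k = (1 - b) * b ^ k := fun k => (hX k).tsum_eq
  refine ⟨p, hstat, fun p' hp' => hG.stationary_unique hstat hp', hb0, 1 - b, sub_pos.mpr hb1, ?_⟩
  have : (fun k => levelMarginal p k / b ^ k) = fun _ => 1 - b := by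
    funext k
    rw [hmarg, mul_div_assoc, div_self (pow_pos hb0 k).ne', mul_one]
  rw [this]
  exact tendsto_const_nhds

end Tandem

/-! ### The function `τ` and its zero -/

section Tau

variable {lam μ₁ μ₂ : ℝ}

/-- In the variable `√z` the sign of `τ` becomes that of a cubic which is convex on the positive
axis. -/
theorem tandemTau_eq (lam μ₁ μ₂ : ℝ) {z : ℝ} (hz : 0 < z) :
    √z * tandemTau lam μ₁ μ₂ z =
      2 * √(lam * μ₁) - (lam + μ₁ + μ₂) * √z + μ₂ * √z ^ 3 := by
  have h1 : √z * √(lam * μ₁ / z) = √(lam * μ₁) := by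
    rw [← Real.sqrt_mul hz.le, mul_div_cancel₀ _ hz.ne']
  have h2 : √z ^ 2 = z := Real.sq_sqrt hz.le
  have h3 : √z ^ 3 = z * √z := by rw [pow_succ, h2]
  rw [tandemTau, h3]
  linear_combination 2 * h1

theorem two_mul_sqrt_mul_lt_add {a b : ℝ} (ha : 0 < a) (hb : 0 < b) (hab : a ≠ b) :
    2 * √(a * b) < a + b := by
  have h1 : 0 < (√a - √b) ^ 2 := by
    refine lt_of_le_of_ne (sq_nonneg _) (Ne.symm (pow_ne_zero 2 (sub_ne_zero.mpr ?_)))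
    exact fun h => hab ((Real.sqrt_inj ha.le hb.le).mp h)
  rw [Real.sqrt_mul ha.le]
  nlinarith [Real.sq_sqrt ha.le, Real.sq_sqrt hb.le]

/-- Once nonpositive, `τ` stays negative up to `1`. -/
theorem tandemTau_neg_of_lt (hlam : 0 < lam) (h₁ : lam < μ₁) (h₂ : 0 < μ₂) {z z' : ℝ} (hz : 0 < z)
    (hzz : z < z') (hz' : z' ≤ 1) (hτ : tandemTau lam μ₁ μ₂ z ≤ 0) :
    tandemTau lam μ₁ μ₂ z' < 0 := by
  have hz'0 : 0 < z' := hz.trans hzz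
  set t := √z with ht
  set t' := √z' with ht'
  have ht0 : 0 < t := Real.sqrt_pos.mpr hz
  have htt : t < t' := Real.sqrt_lt_sqrt hz.le hzz
  have ht1 : t' ≤ 1 := Real.sqrt_le_one.mpr hz'
  have h1 := tandemTau_eq lam μ₁ μ₂ hz
  have h2 := tandemTau_eq lam μ₁ μ₂ hz'0
  have h3 := two_mul_sqrt_mul_lt_add hlam (hlam.trans h₁) h₁.ne
  set c := 2 * √(lam * μ₁) with hc
  rw [← ht] at h1
  rw [← ht'] at h2
  have h4 : c - (lam + μ₁ + μ₂) * t + μ₂ * t ^ 3 ≤ 0 := by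
    rw [← h1]
    exact mul_nonpos_of_nonneg_of_nonpos ht0.le hτ
  -- Convexity of the cubic on `[t, 1]`, with the chord defect written out: its value at `t` is
  -- nonpositive and at `1` it is `c - (lam + μ₁) < 0`.
  have h5 : (1 - t) * (c - (lam + μ₁ + μ₂) * t' + μ₂ * t' ^ 3) < 0 := by
    have e : (1 - t) * (c - (lam + μ₁ + μ₂) * t' + μ₂ * t' ^ 3) =
        (1 - t') * (c - (lam + μ₁ + μ₂) * t + μ₂ * t ^ 3) + (t' - t) * (c - (lam + μ₁)) -
          μ₂ * ((1 - t') * (t' - t) * (1 - t) * (1 + t + t')) := by ring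
    rw [e]
    have e1 : (1 - t') * (c - (lam + μ₁ + μ₂) * t + μ₂ * t ^ 3) ≤ 0 :=
      mul_nonpos_of_nonneg_of_nonpos (by linarith) h4
    have e2 : (t' - t) * (c - (lam + μ₁)) < 0 :=
      mul_neg_of_pos_of_neg (by linarith) (by linarith)
    have e3 : 0 ≤ μ₂ * ((1 - t') * (t' - t) * (1 - t) * (1 + t + t')) := by
      have f1 : 0 ≤ 1 - t' := by linarith
      have f2 : 0 ≤ t' - t := by linarith
      have f3 : 0 ≤ 1 - t := by linarith
      have f4 : 0 ≤ 1 + t + t' := by linarith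
      positivity
    linarith
  have h6 : t' * tandemTau lam μ₁ μ₂ z' < 0 := by
    rw [h2]
    exact (pos_iff_neg_of_mul_neg h5).mp (by linarith)
  exact (pos_iff_neg_of_mul_neg h6).mp (by linarith)

theorem tandemTau_one_neg (hlam : 0 < lam) (h₁ : lam < μ₁) : tandemTau lam μ₁ μ₂ 1 < 0 := by
  have h3 := two_mul_sqrt_mul_lt_add hlam (hlam.trans h₁) h₁.ne
  rw [tandemTau, div_one]
  linarith

theorem exists_unique_zero_tandemTau (hlam : 0 < lam) (h₁ : lam < μ₁) (h₂ : 0 < μ₂) :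
    ∃ η : ℝ, ∀ z : ℝ, (0 < z ∧ z < 1 ∧ tandemTau lam μ₁ μ₂ z = 0) ↔ z = η := by
  have hμ₁ := hlam.trans h₁
  have hpos : 0 < lam * μ₁ := mul_pos hlam hμ₁
  have hA : 0 < lam + μ₁ + μ₂ := by positivity
  obtain ⟨z₀, hz₀, hz₀1, hτ₀⟩ : ∃ z₀ : ℝ, 0 < z₀ ∧ z₀ < 1 ∧ 0 ≤ tandemTau lam μ₁ μ₂ z₀ := by
    -- Chosen so that the square root in `τ` equals `lam + μ₁ + μ₂`.
    refine ⟨lam * μ₁ / (lam + μ₁ + μ₂) ^ 2, by positivity, ?_, ?_⟩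
    · rw [div_lt_one (by positivity)]
      nlinarith [mul_pos hlam h₂, mul_pos hμ₁ h₂, sq_nonneg μ₂, sq_nonneg lam, sq_nonneg μ₁]
    · rw [tandemTau, div_div_cancel₀ hpos.ne', Real.sqrt_sq hA.le]
      have : 0 ≤ μ₂ * (lam * μ₁ / (lam + μ₁ + μ₂) ^ 2) := by positivity
      linarith
  have hcont : ContinuousOn (tandemTau lam μ₁ μ₂) (Set.Icc z₀ 1) := by
    intro z hz
    have hz0 : z ≠ 0 := (lt_of_lt_of_le hz₀ hz.1).ne'
    unfold tandemTau
    refine ContinuousAt.continuousWithinAt ?_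
    fun_prop (disch := exact hz0)
  obtain ⟨η, hη, hη0⟩ := intermediate_value_Icc' hz₀1.le hcont
    ⟨(tandemTau_one_neg (μ₂ := μ₂) hlam h₁).le, hτ₀⟩
  have hηpos : 0 < η := lt_of_lt_of_le hz₀ hη.1
  have hη1 : η < 1 := by
    refine lt_of_le_of_ne hη.2 ?_
    rintro rfl
    exact (tandemTau_one_neg (μ₂ := μ₂) hlam h₁).ne hη0
  refine ⟨η, fun z => ⟨?_, ?_⟩⟩
  · rintro ⟨hz0, hz1, hz⟩
    rcases lt_trichotomy z η with h | h | h
    · exact absurd hη0 (tandemTau_neg_of_lt hlam h₁ h₂ hz0 h hη1.le hz.le).ne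
    · exact h
    · exact absurd hz (tandemTau_neg_of_lt hlam h₁ h₂ hηpos h hz1.le hη0.le).ne
  · rintro rfl
    exact ⟨hηpos, hη1, hη0⟩

/-- The sign of `μ₁ - μ₂` decides on which side of `λ/μ₁` the zero `η` lies. -/
theorem tandemTau_div_left (hlam : 0 < lam) (h₁ : lam < μ₁) :
    tandemTau lam μ₁ μ₂ (lam / μ₁) = (μ₁ - lam) * (1 - μ₂ / μ₁) := by
  have hμ₁ := hlam.trans h₁
  have h : lam * μ₁ / (lam / μ₁) = μ₁ ^ 2 := by field_simp
  rw [tandemTau, h, Real.sqrt_sq hμ₁.le]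
  field_simp
  ring

theorem tandemTau_div_right_neg (hlam : 0 < lam) (h₁ : 0 < μ₁) (h₂ : 0 < μ₂) (h : μ₁ ≠ μ₂) :
    tandemTau lam μ₁ μ₂ (lam / μ₂) < 0 := by
  have h1 : lam * μ₁ / (lam / μ₂) = μ₁ * μ₂ := by field_simp
  have h2 : μ₂ * (1 - lam / μ₂) = μ₂ - lam := by field_simp
  rw [tandemTau, h1, h2]
  linarith [two_mul_sqrt_mul_lt_add h₁ h₂ h]

end Tau

/-! ### The three-term recurrence and its positivity -/

/-- The solution, started from `1`, of the recurrence for left null vectors of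
`Q₀ + z Q₁ + z² Q₂` of the tandem network. -/
noncomputable def tandemSeq (lam μ₁ μ₂ z : ℝ) : ℕ → ℝ
  | 0 => 1
  | 1 => z * (lam + μ₂ * (1 - z)) / μ₁
  | n + 2 => z * ((lam + μ₁ + μ₂ * (1 - z)) * tandemSeq lam μ₁ μ₂ z (n + 1) -
      lam * tandemSeq lam μ₁ μ₂ z n) / μ₁

section Seq

variable {lam μ₁ μ₂ z : ℝ}

theorem continuous_tandemSeq (lam μ₁ μ₂ : ℝ) (n : ℕ) :
    Continuous fun z => tandemSeq lam μ₁ μ₂ z n := by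
  induction n using Nat.twoStepInduction with
  | zero => simp only [tandemSeq]; exact continuous_const
  | one => simp only [tandemSeq]; fun_prop
  | more n ih1 ih2 => simp only [tandemSeq]; fun_prop

/-- A nonnegative solution of the recurrence is positive. -/
theorem tandemSeq_pos_of_nonneg (hlam : 0 < lam) (h₁ : 0 < μ₁) (hz : 0 < z)
    (h : ∀ n, 0 ≤ tandemSeq lam μ₁ μ₂ z n) (n : ℕ) : 0 < tandemSeq lam μ₁ μ₂ z n := by
  induction n with
  | zero => simp [tandemSeq]
  | succ n ih =>
    -- A zero directly after a positive term would make the following term negative.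
    refine lt_of_le_of_ne (h _) fun h0 => ?_
    have h2 := h (n + 2)
    rw [tandemSeq, ← h0, mul_zero, zero_sub] at h2
    have h3 : z * -(lam * tandemSeq lam μ₁ μ₂ z n) / μ₁ < 0 := by
      refine div_neg_of_neg_of_pos (mul_neg_of_pos_of_neg hz ?_) h₁
      have := mul_pos hlam ih
      linarith
    linarith

/-- The phase factor of Jackson's product form solves the recurrence at `ρ₂`, including the equation
at phase `0`. -/
theorem tandemSeq_of_product_form (h₁ : 0 < μ₁) (h₂ : 0 < μ₂) (n : ℕ) :
    tandemSeq lam μ₁ μ₂ (lam / μ₂) n = (lam / μ₁) ^ n := by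
  induction n using Nat.twoStepInduction with
  | zero => simp [tandemSeq]
  | one =>
    rw [tandemSeq]
    field_simp
    ring
  | more n ih1 ih2 =>
    rw [tandemSeq, ih1, ih2]
    simp only [pow_succ]
    generalize (lam / μ₁) ^ n = q
    field_simp
    ring

/-- The successive ratios of the recurrence decrease by `(z / μ₁) h(x)`,
`h(x) = μ₁ x / z + λ / x - s`, so positivity fails as soon as `h` is bounded below by a positive
number. -/
theorem not_forall_tandemSeq_pos (h₁ : 0 < μ₁) (hz : 0 < z)
    {δ : ℝ} (hδ : 0 < δ)
    (hδh : ∀ x, 0 < x → x ≤ z * (lam + μ₂ * (1 - z)) / μ₁ →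
      δ ≤ μ₁ * x / z + lam / x - (lam + μ₁ + μ₂ * (1 - z))) :
    ¬ ∀ n, 0 < tandemSeq lam μ₁ μ₂ z n := by
  intro hf
  set f := tandemSeq lam μ₁ μ₂ z with hfdef
  set x₀ := z * (lam + μ₂ * (1 - z)) / μ₁ with hx₀
  set ε := z / μ₁ * δ with hε
  have hεpos : 0 < ε := mul_pos (div_pos hz h₁) hδ
  have hx : ∀ n : ℕ, f (n + 1) / f n ≤ x₀ - n * ε := by
    intro n
    induction n with
    | zero =>
      have e0 : f 0 = 1 := by rw [hfdef, tandemSeq]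
      have e1 : f 1 = x₀ := by rw [hfdef, tandemSeq]
      simp [e0, e1]
    | succ n ih =>
      have hn := hf n
      have hn1 := hf (n + 1)
      set x := f (n + 1) / f n with hxdef
      have hxpos : 0 < x := div_pos hn1 hn
      have hnε : 0 ≤ (n : ℝ) * ε := mul_nonneg (Nat.cast_nonneg n) hεpos.le
      have h1 := hδh x hxpos (by linarith)
      have h2 : f (n + 2) / f (n + 1) =
          x - z / μ₁ * (μ₁ * x / z + lam / x - (lam + μ₁ + μ₂ * (1 - z))) := by
        have e2 : f (n + 2) = z * ((lam + μ₁ + μ₂ * (1 - z)) * f (n + 1) - lam * f n) / μ₁ := by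
          rw [hfdef, tandemSeq]
        rw [e2, hxdef]
        have a1 := hn.ne'
        have a2 := hn1.ne'
        field_simp
        ring
      have h3 := mul_le_mul_of_nonneg_left h1 (div_pos hz h₁).le
      rw [h2]
      push_cast
      linarith
  obtain ⟨n, hn⟩ := exists_nat_gt (x₀ / ε)
  rw [div_lt_iff₀ hεpos] at hn
  have h1 := hx n
  have h2 : 0 < f (n + 1) / f n := div_pos (hf _) (hf _)
  linarith

/-- By the arithmetic-geometric mean inequality `μ₁ x / z + λ / x` is at least `2 √(λ μ₁ / z)`, so
`τ(z)` itself is the lower bound `δ` if it is positive. -/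
theorem tandemTau_nonpos_of_forall_tandemSeq_pos (hlam : 0 < lam) (h₁ : 0 < μ₁) (hz : 0 < z)
    (hf : ∀ n, 0 < tandemSeq lam μ₁ μ₂ z n) : tandemTau lam μ₁ μ₂ z ≤ 0 := by
  by_contra hτ
  rw [not_le] at hτ
  refine not_forall_tandemSeq_pos h₁ hz hτ (fun x hx _ => ?_) hf
  have h1 : √(lam * μ₁ / z) = √(μ₁ * x / z * (lam / x)) := by
    congr 1
    field_simp
  have a0 : 0 ≤ μ₁ * x / z := by positivity
  have b0 : 0 ≤ lam / x := by positivity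
  have h2 : 2 * √(μ₁ * x / z * (lam / x)) ≤ μ₁ * x / z + lam / x := by
    rw [Real.sqrt_mul a0]
    nlinarith [Real.sq_sqrt a0, Real.sq_sqrt b0, sq_nonneg (√(μ₁ * x / z) - √(lam / x))]
  rw [tandemTau, h1]
  linarith

/-- Here `τ(z)` may be negative, so the starting ratio `x₀` matters: since `μ₁ x₀ ≤ λ` and `x₀ ≤ z`,
the function `h` decreases on `(0, x₀]`, and `h(x₀) > 0` because `z < ρ₂`. -/
theorem not_forall_tandemSeq_pos_of_lt (hlam : 0 < lam) (h₁ : 0 < μ₁) (h₂ : lam < μ₂)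
    (hz : lam / μ₁ ≤ z) (hz' : z < lam / μ₂) : ¬ ∀ n, 0 < tandemSeq lam μ₁ μ₂ z n := by
  have hμ₂ : 0 < μ₂ := hlam.trans h₂
  have hz0 : 0 < z := lt_of_lt_of_le (div_pos hlam h₁) hz
  have hzμ : μ₂ * z < lam := by rw [lt_div_iff₀ hμ₂] at hz'; linarith
  have hzμ₁ : lam ≤ z * μ₁ := by rwa [div_le_iff₀ h₁] at hz
  have hz1 : z < 1 := hz'.trans ((div_lt_one hμ₂).mpr h₂)
  have hq : 0 < (1 - z) * (lam - μ₂ * z) := mul_pos (by linarith) (by linarith)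
  set x₀ := z * (lam + μ₂ * (1 - z)) / μ₁ with hx₀
  have hs : 0 < lam + μ₂ * (1 - z) := by
    have : 0 < μ₂ * (1 - z) := mul_pos hμ₂ (by linarith)
    linarith
  have hx₀pos : 0 < x₀ := by positivity
  have hx₀μ : μ₁ * x₀ = lam - (1 - z) * (lam - μ₂ * z) := by
    rw [hx₀]
    field_simp
    ring
  have hh₀ : μ₁ * x₀ / z + lam / x₀ - (lam + μ₁ + μ₂ * (1 - z)) =
      (1 - z) * (lam - μ₂ * z) / x₀ := by
    have e : μ₁ * x₀ / z = lam + μ₂ * (1 - z) := by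
      rw [hx₀]
      field_simp
    rw [e, ← mul_right_inj' hx₀pos.ne']
    field_simp
    linarith
  refine not_forall_tandemSeq_pos h₁ hz0 (δ := (1 - z) * (lam - μ₂ * z) / x₀)
    (div_pos hq hx₀pos) fun x hx hxx => ?_
  rw [← hh₀]
  have key : (μ₁ * x / z + lam / x) - (μ₁ * x₀ / z + lam / x₀) =
      (x₀ - x) * (lam * z - μ₁ * (x * x₀)) / (x * x₀ * z) := by
    field_simp
    ring
  have h3 : 0 ≤ (x₀ - x) * (lam * z - μ₁ * (x * x₀)) / (x * x₀ * z) := by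
    refine div_nonneg (mul_nonneg (by linarith) ?_) (by positivity)
    have e1 : μ₁ * (x * x₀) ≤ x₀ * lam := by
      calc μ₁ * (x * x₀) = x * (μ₁ * x₀) := by ring
        _ ≤ x₀ * lam := mul_le_mul hxx (by linarith) (by positivity) hx₀pos.le
    have e2 : x₀ ≤ z := by
      have : μ₁ * x₀ ≤ μ₁ * z := by linarith
      exact le_of_mul_le_mul_left this h₁
    have e3 : x₀ * lam ≤ z * lam := mul_le_mul_of_nonneg_right e2 hlam.le
    linarith
  linarith

end Seq

/-! ### Neuts's matrix of the truncated system -/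

section FiniteTandem

variable {lam μ₁ μ₂ : ℝ} {m : ℕ}

/-- Extension of a finite vector to all indices by zero. -/
noncomputable def natExtend (w : Fin (m + 1) → ℝ) (n : ℕ) : ℝ :=
  if h : n < m + 1 then w ⟨n, h⟩ else 0

theorem natExtend_val (w : Fin (m + 1) → ℝ) (i : Fin (m + 1)) : natExtend w i = w i :=
  dif_pos i.2

theorem finiteTandem_Q2 : (finiteTandem lam μ₁ μ₂ m).Q2 = μ₂ • (1 : Matrix _ _ ℝ) := by
  ext i j
  simp [finiteTandem, tandemBlocks, Matrix.one_apply, Fin.ext_iff, eq_comm]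

theorem vecMul_finiteTandem_Q0 (X : ℕ → ℝ) (j : Fin (m + 1)) :
    Matrix.vecMul (fun i : Fin (m + 1) => X i) (finiteTandem lam μ₁ μ₂ m).Q0 j =
      if (j : ℕ) < m then X (j + 1) * μ₁ else 0 := by
  have h := (isPhaseEnumeration_fin m).hasSum_down_col X j μ₁
  simp only [Nat.cast_lt] at h
  exact (hasSum_fintype _).unique h

theorem vecMul_finiteTandem_Q1 (X : ℕ → ℝ) (j : Fin (m + 1)) :
    Matrix.vecMul (fun i : Fin (m + 1) => X i) (finiteTandem lam μ₁ μ₂ m).Q1 j =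
      (if 0 < (j : ℕ) then X (j - 1) * lam else 0) +
        X j * -((if (j : ℕ) < m then lam else 0) + (if 0 < (j : ℕ) then μ₁ else 0) + μ₂) := by
  have h := (isPhaseEnumeration_fin m).hasSum_up_col X j lam
    fun i : Fin (m + 1) => -((if ((i : ℕ) : ℕ∞) < (m : ℕ∞) then lam else 0) +
      (if 0 < (i : ℕ) then μ₁ else 0) + μ₂)
  simp only [Nat.cast_lt] at h
  refine (hasSum_fintype _).unique (h.congr_fun fun i => ?_)
  simp only [finiteTandem, tandemBlocks, Nat.cast_lt]

theorem vecMul_finiteTandem_pencil (z : ℝ) (X : ℕ → ℝ) (j : Fin (m + 1)) :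
    Matrix.vecMul (fun i : Fin (m + 1) => X i) ((finiteTandem lam μ₁ μ₂ m).pencil z) j =
      (if (j : ℕ) < m then X (j + 1) * μ₁ else 0) +
        z * ((if 0 < (j : ℕ) then X (j - 1) * lam else 0) +
        X j * -((if (j : ℕ) < m then lam else 0) + (if 0 < (j : ℕ) then μ₁ else 0) + μ₂)) +
        z ^ 2 * (μ₂ * X j) := by
  rw [QBDBlocks.pencil, finiteTandem_Q2, Matrix.vecMul_add, Matrix.vecMul_add, Matrix.vecMul_smul,
    Matrix.vecMul_smul, Matrix.vecMul_smul, Matrix.vecMul_one]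
  simp only [Pi.add_apply, Pi.smul_apply, smul_eq_mul]
  rw [vecMul_finiteTandem_Q0, vecMul_finiteTandem_Q1]

theorem finiteTandem_isMetzler (hlam : 0 ≤ lam) (h₁ : 0 ≤ μ₁) (h₂ : 0 ≤ μ₂) :
    (finiteTandem lam μ₁ μ₂ m).IsMetzler where
  Q0_nonneg i j := by
    simp only [finiteTandem, tandemBlocks]
    split_ifs <;> first | assumption | exact le_rfl
  Q1_offDiag_nonneg i j hij := by
    have hne : (j : ℕ) ≠ i := fun h => hij (Fin.ext h.symm)
    simp only [finiteTandem, tandemBlocks]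
    rw [if_neg hne]
    split_ifs <;> first | assumption | exact le_rfl
  Q2_nonneg i j := by
    simp only [finiteTandem, tandemBlocks]
    split_ifs <;> first | assumption | exact le_rfl

theorem finiteTandem_row_sums (i : Fin (m + 1)) :
    ∑ j, (finiteTandem lam μ₁ μ₂ m).Q0 i j + ∑ j, (finiteTandem lam μ₁ μ₂ m).Q1 i j +
      ∑ j, (finiteTandem lam μ₁ μ₂ m).Q2 i j = 0 ∧
    ∑ j, (finiteTandem lam μ₁ μ₂ m).Q0 i j + ∑ j, (finiteTandem lam μ₁ μ₂ m).Qt1 i j = 0 := by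
  have hφ := isPhaseEnumeration_fin m
  have e0 : ∑ j, (finiteTandem lam μ₁ μ₂ m).Q0 i j = _ :=
    (hasSum_fintype _).unique (hφ.hasSum_down_row i μ₁)
  have e1 : ∑ j, (finiteTandem lam μ₁ μ₂ m).Q1 i j = _ :=
    (hasSum_fintype _).unique (hφ.hasSum_up_row i lam _)
  have et : ∑ j, (finiteTandem lam μ₁ μ₂ m).Qt1 i j = _ :=
    (hasSum_fintype _).unique (hφ.hasSum_up_row i lam _)
  have e2 : ∑ j, (finiteTandem lam μ₁ μ₂ m).Q2 i j = _ :=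
    (hasSum_fintype _).unique (hφ.hasSum_diag_row i μ₂)
  rw [e0, e1, et, e2]
  constructor <;> ring

/-- Positive solutions of the column inequalities are superinvariant vectors of the pencil. -/
theorem vecMul_finiteTandem_pencil_nonpos (hm : 1 ≤ m) {z : ℝ} (hz : 0 < z) {X : ℕ → ℝ}
    (hfirst : μ₁ * X 1 ≤ z * (lam + μ₂ * (1 - z)) * X 0)
    (hmid : ∀ n, n + 1 < m → μ₁ * X (n + 2) + z * lam * X n ≤
      z * (lam + μ₁ + μ₂ * (1 - z)) * X (n + 1))
    (hlast : lam * X (m - 1) ≤ (μ₁ + μ₂ * (1 - z)) * X m) (j : Fin (m + 1)) :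
    Matrix.vecMul (fun i : Fin (m + 1) => X i) ((finiteTandem lam μ₁ μ₂ m).pencil z) j ≤ 0 := by
  rw [vecMul_finiteTandem_pencil]
  obtain ⟨n, hn⟩ := j
  simp only
  rcases Nat.lt_or_ge n m with hnm | hnm
  · rw [if_pos hnm, if_pos hnm]
    cases n with
    | zero =>
      simp only [lt_irrefl, if_false, zero_add]
      linarith
    | succ n =>
      rw [if_pos (Nat.succ_pos n), if_pos (Nat.succ_pos n), Nat.add_sub_cancel]
      have := hmid n hnm
      rw [show n + 1 + 1 = n + 2 from rfl]
      linarith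
  · have hnm' : n = m := by omega
    subst hnm'
    rw [if_neg (lt_irrefl _), if_neg (lt_irrefl _), if_pos (show 0 < n from hm),
      if_pos (show 0 < n from hm)]
    have := mul_le_mul_of_nonneg_left hlast hz.le
    linarith

/-- Left null vectors of the pencil are multiples of `tandemSeq`, which then satisfies the
boundary condition at the full first queue. -/
theorem eq_tandemSeq_of_vecMul_pencil_eq_zero (h₁ : 0 < μ₁) (hm : 1 ≤ m) {z : ℝ} (hz : 0 < z)
    {x : Fin (m + 1) → ℝ} (hx : Matrix.vecMul x ((finiteTandem lam μ₁ μ₂ m).pencil z) = 0) :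
    (∀ i, x i = x 0 * tandemSeq lam μ₁ μ₂ z i) ∧
      (x 0 ≠ 0 → lam * tandemSeq lam μ₁ μ₂ z (m - 1) =
        (μ₁ + μ₂ * (1 - z)) * tandemSeq lam μ₁ μ₂ z m) := by
  -- Only indices up to `m` are read below, so the default value zero never enters.
  set X := natExtend x with hX
  have hxX : x = fun i : Fin (m + 1) => X i := funext fun i => (natExtend_val x i).symm
  have hX0 : X 0 = x 0 := natExtend_val x 0
  have hcol : ∀ n (hn : n < m + 1), (if n < m then X (n + 1) * μ₁ else 0) +
        z * ((if 0 < n then X (n - 1) * lam else 0) +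
        X n * -((if n < m then lam else 0) + (if 0 < n then μ₁ else 0) + μ₂)) +
        z ^ 2 * (μ₂ * X n) = 0 := by
    intro n hn
    have h := vecMul_finiteTandem_pencil (lam := lam) (μ₁ := μ₁) (μ₂ := μ₂) z X ⟨n, hn⟩
    rw [← hxX, hx] at h
    exact h.symm
  have hseq : ∀ n, n ≤ m → X n = X 0 * tandemSeq lam μ₁ μ₂ z n := by
    intro n
    induction n using Nat.twoStepInduction with
    | zero => intro _; simp [tandemSeq]
    | one =>
      intro _
      have h := hcol 0 (by omega)
      rw [if_pos (show 0 < m from hm), if_pos (show 0 < m from hm)] at h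
      simp only [lt_irrefl, if_false, zero_add] at h
      rw [tandemSeq, ← mul_left_inj' h₁.ne']
      field_simp
      linarith
    | more n ih1 ih2 =>
      intro hn
      have h := hcol (n + 1) (by omega)
      rw [if_pos (show n + 1 < m by omega), if_pos (show n + 1 < m by omega),
        if_pos (Nat.succ_pos n), if_pos (Nat.succ_pos n), Nat.add_sub_cancel,
        show n + 1 + 1 = n + 2 from rfl, ih1 (by omega), ih2 (by omega)] at h
      rw [tandemSeq, ← mul_left_inj' h₁.ne']
      field_simp
      linarith
  refine ⟨fun i => ?_, fun hx0 => ?_⟩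
  · rw [← hX0, ← hseq i (Nat.lt_succ_iff.mp i.2), hX, natExtend_val]
  · have h := hcol m (by omega)
    rw [if_neg (lt_irrefl _), if_neg (lt_irrefl _), if_pos (show 0 < m from hm),
      if_pos (show 0 < m from hm), hseq m le_rfl, hseq (m - 1) (Nat.sub_le _ _), hX0] at h
    have hz0 : z * x 0 ≠ 0 := mul_ne_zero hz.ne' hx0
    rw [← mul_right_inj' hz0]
    linarith

/-- All rows of Neuts's matrix, except the one of the empty first queue, are strictly positive. -/
theorem finiteTandem_neutsMatrix_pos (hlam : 0 < lam) (h₁ : 0 < μ₁) (h₂ : 0 < μ₂)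
    {R : Matrix (Fin (m + 1)) (Fin (m + 1)) ℝ} (hR : ∀ i j, 0 ≤ R i j)
    (heq : (finiteTandem lam μ₁ μ₂ m).Q0 + R * (finiteTandem lam μ₁ μ₂ m).Q1 +
      R * R * (finiteTandem lam μ₁ μ₂ m).Q2 = 0) {i : Fin (m + 1)} (hi : 0 < (i : ℕ))
    (j : Fin (m + 1)) : 0 < R i j := by
  set D : Fin (m + 1) → ℝ := fun j =>
    (if (j : ℕ) < m then lam else 0) + (if 0 < (j : ℕ) then μ₁ else 0) + μ₂ with hD
  have hDpos : ∀ j, 0 < D j := by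
    intro j
    simp only [hD]
    split_ifs <;> linarith
  -- With the diagonal of `Q₁` moved to the left every term on the right is nonnegative. So
  -- positivity starts from `Q₀` just left of the diagonal, spreads right through arrivals, and
  -- spreads left through `R²`.
  have hentry : ∀ i j : Fin (m + 1), D j * R i j = (if (i : ℕ) = j + 1 then μ₁ else 0) +
      (if 0 < (j : ℕ) then natExtend (R i) (j - 1) * lam else 0) + μ₂ * ∑ k, R i k * R k j := by
    intro i j
    have h := congrFun (congrFun heq i) j
    rw [finiteTandem_Q2, Matrix.mul_smul, Matrix.mul_one] at h
    simp only [Matrix.add_apply, Matrix.smul_apply, smul_eq_mul, Matrix.zero_apply] at h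
    have hQ1 := vecMul_finiteTandem_Q1 (lam := lam) (μ₁ := μ₁) (μ₂ := μ₂) (natExtend (R i)) j
    rw [show (fun k : Fin (m + 1) => natExtend (R i) k) = R i from
      funext fun k => natExtend_val (R i) k] at hQ1
    replace hQ1 : (R * (finiteTandem lam μ₁ μ₂ m).Q1) i j = _ := hQ1
    have hQ0 : (finiteTandem lam μ₁ μ₂ m).Q0 i j = if (i : ℕ) = j + 1 then μ₁ else 0 := rfl
    rw [hQ1, hQ0, natExtend_val, Matrix.mul_apply] at h
    linarith
  have hRR : ∀ i j : Fin (m + 1), 0 ≤ μ₂ * ∑ k, R i k * R k j := fun i j =>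
    mul_nonneg h₂.le (Finset.sum_nonneg fun k _ => mul_nonneg (hR i k) (hR k j))
  have hEnn : ∀ (i : Fin (m + 1)) n, 0 ≤ natExtend (R i) n := by
    intro i n
    unfold natExtend
    split_ifs
    · exact hR _ _
    · exact le_rfl
  have hmid : ∀ i j : Fin (m + 1),
      0 ≤ if 0 < (j : ℕ) then natExtend (R i) (j - 1) * lam else 0 := by
    intro i j
    split_ifs
    · exact mul_nonneg (hEnn i _) hlam.le
    · exact le_rfl
  have hQ0nn : ∀ i j : Fin (m + 1), 0 ≤ if (i : ℕ) = j + 1 then μ₁ else 0 := by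
    intro i j
    split_ifs
    · exact h₁.le
    · exact le_rfl
  have hpos_of : ∀ i j, 0 < D j * R i j → 0 < R i j := fun i j h =>
    (pos_iff_pos_of_mul_pos h).mp (hDpos j)
  have hsub : ∀ i j : Fin (m + 1), (i : ℕ) = j + 1 → 0 < R i j := by
    intro i j hij
    refine hpos_of i j ?_
    have := hQ0nn i j
    rw [hentry, if_pos hij]
    linarith [hmid i j, hRR i j]
  have hright : ∀ i j k : Fin (m + 1), (k : ℕ) = j + 1 → 0 < R i j → 0 < R i k := by
    intro i j k hkj hij
    refine hpos_of i k ?_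
    have e : natExtend (R i) ((k : ℕ) - 1) = R i j := by
      rw [hkj, Nat.add_sub_cancel, natExtend_val]
    rw [hentry, if_pos (by omega : 0 < (k : ℕ)), e]
    linarith [hQ0nn i k, hRR i k, mul_pos hij hlam]
  have hleft : ∀ i j k : Fin (m + 1), (k : ℕ) = j + 1 → 0 < R i k → 0 < R i j := by
    intro i j k hkj hik
    refine hpos_of i j ?_
    rw [hentry]
    have h1 := Finset.single_le_sum (f := fun k => R i k * R k j)
      (fun k _ => mul_nonneg (hR i k) (hR k j)) (Finset.mem_univ k)
    have h2 : 0 < μ₂ * ∑ k, R i k * R k j :=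
      mul_pos h₂ (lt_of_lt_of_le (mul_pos hik (hsub k j hkj)) h1)
    linarith [hQ0nn i j, hmid i j]
  have hup : ∀ n (j : Fin (m + 1)), (j : ℕ) = i - 1 + n → 0 < R i j := by
    intro n
    induction n with
    | zero => exact fun j hj => hsub i j (by omega)
    | succ n ih =>
      intro j hj
      exact hright i ⟨i - 1 + n, by omega⟩ j (by simpa using by omega) (ih _ rfl)
  have hdown : ∀ n (j : Fin (m + 1)), (j : ℕ) + n = i - 1 → 0 < R i j := by
    intro n
    induction n with
    | zero => exact fun j hj => hsub i j (by omega)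
    | succ n ih =>
      intro j hj
      exact hleft i j ⟨j + 1, by omega⟩ rfl (ih _ (by simpa using by omega))
  rcases le_total (i - 1 : ℕ) j with h | h
  · exact hup (j - (i - 1)) j (by omega)
  · exact hdown (i - 1 - j) j (by omega)

/-- Neuts's matrix of the truncated tandem network, its Perron–Frobenius eigenvalue, the
characterization of the latter by the recurrence, and the decay rate. -/
theorem exists_finiteTandem_neutsMatrix (hlam : 0 < lam) (h₁ : lam < μ₁) (h₂ : lam < μ₂)
    (hm : 1 ≤ m) :
    ∃ (R : Matrix (Fin (m + 1)) (Fin (m + 1)) ℝ) (r : ℝ),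
      (finiteTandem lam μ₁ μ₂ m).IsNeutsR R ∧ IsPerronFrobeniusEigenvalue R r ∧
      (finiteTandem lam μ₁ μ₂ m).HasStationaryDecayRate r ∧
      r < lam / μ₂ ∧ (∀ n, n ≤ m → 0 < tandemSeq lam μ₁ μ₂ r n) ∧
      lam * tandemSeq lam μ₁ μ₂ r (m - 1) = (μ₁ + μ₂ * (1 - r)) * tandemSeq lam μ₁ μ₂ r m ∧
      ∀ (z : ℝ) (X : ℕ → ℝ), 0 < z → (∀ n, n ≤ m → 0 < X n) →
        μ₁ * X 1 ≤ z * (lam + μ₂ * (1 - z)) * X 0 →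
        (∀ n, n + 1 < m → μ₁ * X (n + 2) + z * lam * X n ≤
          z * (lam + μ₁ + μ₂ * (1 - z)) * X (n + 1)) →
        lam * X (m - 1) ≤ (μ₁ + μ₂ * (1 - z)) * X m → r ≤ z := by
  have hμ₁ := hlam.trans h₁
  have hμ₂ := hlam.trans h₂
  set a := lam / μ₁ with ha
  have ha0 : 0 < a := div_pos hlam hμ₁
  have haμ : lam = a * μ₁ := (div_mul_cancel₀ _ hμ₁.ne').symm
  have hm' : m = m - 1 + 1 := by omega
  have hB : (finiteTandem lam μ₁ μ₂ m).IsMetzler := finiteTandem_isMetzler hlam.le hμ₁.le hμ₂.le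
  -- At `z = 1` the pencil is the generator of the first queue alone, with invariant vector `aⁱ`.
  obtain ⟨R, hR, hzero, hdom⟩ := QBDBlocks.exists_isNeutsR hB
    (w₁ := fun i : Fin (m + 1) => a ^ (i : ℕ)) (fun i => pow_pos ha0 _)
    (vecMul_finiteTandem_pencil_nonpos hm zero_lt_one (X := fun n => a ^ n)
      (by simp only [pow_one, pow_zero]; linarith)
      (fun n _ => by
        simp only [pow_succ]
        rw [haμ]
        exact le_of_eq (by ring))
      (by
        nth_rw 2 [hm']
        rw [pow_succ, haμ]
        exact le_of_eq (by ring)))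
  have hRnn := hR.nonneg
  have hpos : ∀ i : Fin (m + 1), 0 < (i : ℕ) → ∀ j, 0 < R i j := fun i hi j =>
    finiteTandem_neutsMatrix_pos hlam hμ₁ hμ₂ hRnn hR.equation hi j
  have hrow : ∀ i, (∀ j, R i j = 0) ∨ (∀ j, 0 < R i j) := by
    intro i
    rcases Nat.eq_zero_or_pos (i : ℕ) with h | h
    · refine Or.inl (hzero i fun j => ?_)
      simp only [finiteTandem, tandemBlocks]
      exact if_neg (by omega)
    · exact Or.inr (hpos i h)
  have hne : ∃ i, ∀ j, 0 < R i j := ⟨⟨1, by omega⟩, hpos _ Nat.one_pos⟩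
  obtain ⟨r, w, hr, hw, hwR⟩ := exists_pos_left_eigenvector hrow hne
  -- Applying a left eigenvector of `R` to the matrix equation replaces each `R` by `r`.
  have hpencil : ∀ x : Fin (m + 1) → ℝ, Matrix.vecMul x R = r • x →
      Matrix.vecMul x ((finiteTandem lam μ₁ μ₂ m).pencil r) = 0 := by
    intro x hx
    have h : Matrix.vecMul x ((finiteTandem lam μ₁ μ₂ m).Q0 +
        R * (finiteTandem lam μ₁ μ₂ m).Q1 + R * R * (finiteTandem lam μ₁ μ₂ m).Q2) = 0 := by
      rw [hR.equation, Matrix.vecMul_zero]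
    rw [Matrix.vecMul_add, Matrix.vecMul_add, ← Matrix.vecMul_vecMul, ← Matrix.vecMul_vecMul,
      ← Matrix.vecMul_vecMul, hx, Matrix.smul_vecMul, Matrix.smul_vecMul, hx, smul_smul,
      Matrix.smul_vecMul, ← pow_two] at h
    rw [QBDBlocks.pencil, Matrix.vecMul_add, Matrix.vecMul_add, Matrix.vecMul_smul,
      Matrix.vecMul_smul]
    exact h
  obtain ⟨hwf, hend⟩ := eq_tandemSeq_of_vecMul_pencil_eq_zero hμ₁ hm hr (hpencil w hwR)
  have hend := hend (hw 0).ne'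
  have hfpos : ∀ n, n ≤ m → 0 < tandemSeq lam μ₁ μ₂ r n := by
    intro n hn
    have h1 := hw ⟨n, by omega⟩
    rw [hwf] at h1
    exact (pos_iff_pos_of_mul_pos h1).mp (hw 0)
  have hmin : ∀ (z : ℝ) (X : ℕ → ℝ), 0 < z → (∀ n, n ≤ m → 0 < X n) →
        μ₁ * X 1 ≤ z * (lam + μ₂ * (1 - z)) * X 0 →
        (∀ n, n + 1 < m → μ₁ * X (n + 2) + z * lam * X n ≤
          z * (lam + μ₁ + μ₂ * (1 - z)) * X (n + 1)) →
        lam * X (m - 1) ≤ (μ₁ + μ₂ * (1 - z)) * X m → r ≤ z := by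
    intro z X hz hX hfirst hmid hlast
    have hXpos : ∀ i : Fin (m + 1), 0 < X i := fun i => hX i (Nat.lt_succ_iff.mp i.2)
    exact le_of_subinvariant_of_superinvariant hRnn (fun i => (hw i).le) ⟨0, (hw 0).ne'⟩
      (fun j => by rw [hwR]; rfl) hXpos
      (hdom z _ hz.le hXpos (vecMul_finiteTandem_pencil_nonpos hm hz hfirst hmid hlast))
  have hρ : 0 < lam / μ₂ := div_pos hlam hμ₂
  have hρμ : μ₂ * (1 - lam / μ₂) = μ₂ - lam := by field_simp
  -- The vector `aⁿ` solves all column equations at `ρ₂` except the last, where there is slack `(μ₂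
  -- - lam) aᵐ`. The slack excludes equality, since at `r` the last equation is exact.
  have hrρ : r < lam / μ₂ := by
    refine lt_of_le_of_ne ?_ ?_
    · refine hmin (lam / μ₂) (fun n => a ^ n) hρ (fun n _ => pow_pos ha0 n) ?_ (fun n _ => ?_) ?_
      · rw [hρμ, ha]
        refine le_of_eq ?_
        field_simp
        ring
      · rw [hρμ]
        refine le_of_eq ?_
        simp only [pow_succ]
        generalize a ^ n = q
        rw [ha]
        field_simp
        ring
      · have e : a ^ m = a ^ (m - 1) * a := by
          nth_rw 1 [hm']
          rw [pow_succ]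
        have e2 : 0 ≤ (μ₂ - lam) * a ^ m := mul_nonneg (by linarith) (pow_pos ha0 m).le
        have e3 : lam * a ^ (m - 1) = μ₁ * a ^ m := by rw [e]; nth_rw 1 [haμ]; ring
        rw [hρμ, e3]
        linarith
    · intro hcon
      rw [hcon, hρμ, tandemSeq_of_product_form hμ₁ hμ₂, tandemSeq_of_product_form hμ₁ hμ₂,
        ← ha] at hend
      have e : a ^ m = a ^ (m - 1) * a := by
        nth_rw 1 [hm']
        rw [pow_succ]
      have e2 : 0 < (μ₂ - lam) * a ^ m := mul_pos (by linarith) (pow_pos ha0 m)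
      have e3 : lam * a ^ (m - 1) = μ₁ * a ^ m := by rw [e]; nth_rw 1 [haμ]; ring
      rw [e3] at hend
      linarith
  have hr1 : r < 1 := hrρ.trans ((div_lt_one hμ₂).mpr h₂)
  refine ⟨R, r, hR, ⟨hr, ?_, ?_, w, hw, hwR⟩, ?_, hrρ, hfpos, hend, hmin⟩
  · refine rootMultiplicity_charpoly_eq_one hRnn hw hwR fun x hx => ?_
    have hxf := (eq_tandemSeq_of_vecMul_pencil_eq_zero hμ₁ hm hr (hpencil x hx)).1
    refine ⟨x 0 / w 0, funext fun i => ?_⟩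
    rw [Pi.smul_apply, smul_eq_mul, hxf i, hwf i, div_mul_eq_mul_div, eq_div_iff (hw 0).ne']
    ring
  · exact fun z hz => norm_le_of_mem_spectrum hRnn hw (fun j => by rw [hwR]; rfl) hz
  · refine QBDBlocks.hasStationaryDecayRate_of_neutsMatrix
      (tandemBlocks_isBoundedIrreducibleGenerator hlam hμ₁ hμ₂ (isPhaseEnumeration_fin m)
        (by exact_mod_cast hm)) hμ₂.le finiteTandem_Q2 ?_ (fun i => (finiteTandem_row_sums i).1)
      (fun i => (finiteTandem_row_sums i).2) hRnn hR.equation hne hw hr hr1 hwR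
    intro i j hij
    have hne : (j : ℕ) ≠ i := fun h => hij (Fin.ext h.symm)
    simp only [tandemBlocks]
    rw [if_neg hne]
    split_ifs <;> first | exact hlam.le | exact le_rfl

end FiniteTandem

/-! ### Comparison of capacities and the vector at `η` -/

section Limits

variable {lam μ₁ μ₂ : ℝ}

theorem tandemSeq_one_eq (h₁ : 0 < μ₁) (z : ℝ) :
    μ₁ * tandemSeq lam μ₁ μ₂ z 1 = z * (lam + μ₂ * (1 - z)) * tandemSeq lam μ₁ μ₂ z 0 := by
  simp only [tandemSeq]
  field_simp

theorem tandemSeq_add_two_eq (h₁ : 0 < μ₁) (z : ℝ) (n : ℕ) :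
    μ₁ * tandemSeq lam μ₁ μ₂ z (n + 2) + z * lam * tandemSeq lam μ₁ μ₂ z n =
      z * (lam + μ₁ + μ₂ * (1 - z)) * tandemSeq lam μ₁ μ₂ z (n + 1) := by
  rw [tandemSeq]
  field_simp
  ring

/-- The solution for capacity `m + 1` violates the boundary condition for capacity `m`. -/
theorem tandemSeq_boundary_lt (h₁ : 0 < μ₁) {m : ℕ} (hm : 1 ≤ m) {z : ℝ} (hz : 0 < z)
    (hz1 : z < 1) (hzμ : μ₂ * z < μ₁) (hpos : 0 < tandemSeq lam μ₁ μ₂ z (m + 1))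
    (hend : lam * tandemSeq lam μ₁ μ₂ z m = (μ₁ + μ₂ * (1 - z)) * tandemSeq lam μ₁ μ₂ z (m + 1)) :
    lam * tandemSeq lam μ₁ μ₂ z (m - 1) < (μ₁ + μ₂ * (1 - z)) * tandemSeq lam μ₁ μ₂ z m := by
  obtain ⟨n, rfl⟩ : ∃ n, m = n + 1 := ⟨m - 1, by omega⟩
  rw [Nat.add_sub_cancel]
  have h := tandemSeq_add_two_eq (lam := lam) (μ₂ := μ₂) h₁ z n
  rw [show n + 1 + 1 = n + 2 from rfl] at hend hpos
  -- By the recurrence and the boundary condition, this product is `z` times the slack in the claim.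
  have key : 0 < (1 - z) * (μ₁ - μ₂ * z) * tandemSeq lam μ₁ μ₂ z (n + 2) :=
    mul_pos (mul_pos (by linarith) (by linarith)) hpos
  refine lt_of_mul_lt_mul_left ?_ hz.le
  linear_combination key + h + z * hend

/-- The geometric vector with ratio `√(λ η / μ₁)` is superinvariant at the zero `η` of `τ`. -/
theorem geometric_superinvariant (hlam : 0 < lam) (h₁ : lam < μ₁) {η : ℝ} (hη : 0 < η)
    (hτ : tandemTau lam μ₁ μ₂ η = 0) (hημ : η * μ₁ ≤ lam) :
    ∃ β : ℝ, 0 < β ∧ μ₁ * β ≤ η * (lam + μ₂ * (1 - η)) ∧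
      (μ₁ * β ^ 2 + η * lam = η * (lam + μ₁ + μ₂ * (1 - η)) * β) ∧
      lam ≤ (μ₁ + μ₂ * (1 - η)) * β := by
  have hμ₁ := hlam.trans h₁
  set q := √(lam * μ₁ / η) with hq
  have hqpos : 0 < q := Real.sqrt_pos.mpr (by positivity)
  have hq2 : q ^ 2 * η = lam * μ₁ := by
    rw [hq, Real.sq_sqrt (by positivity), div_mul_cancel₀ _ hη.ne']
  -- `τ(η) = 0` means that the characteristic quadratic has the double root `η q / μ₁`.
  have hs : lam + μ₁ + μ₂ * (1 - η) = 2 * q := by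
    rw [tandemTau, ← hq] at hτ
    linarith
  -- Here `η ≤ λ/μ₁` enters: the inequality at phase `0` amounts to `μ₁ ≤ q`, and the one at the
  -- full queue to `lam ≤ q`.
  have hqμ : μ₁ ≤ q := by
    rw [hq]
    refine Real.le_sqrt_of_sq_le ?_
    rw [le_div_iff₀ hη]
    nlinarith
  have hqlam : lam ≤ q := h₁.le.trans hqμ
  refine ⟨η * q / μ₁, by positivity, ?_, ?_, ?_⟩
  · rw [mul_div_cancel₀ _ hμ₁.ne']
    exact mul_le_mul_of_nonneg_left (by linarith) hη.le
  · rw [hs]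
    field_simp
    linear_combination -hq2
  · have e : μ₁ + μ₂ * (1 - η) = 2 * q - lam := by linarith
    rw [e, ← mul_div_assoc, le_div_iff₀ hμ₁]
    have : 0 ≤ η * q * (q - lam) := mul_nonneg (by positivity) (by linarith)
    linarith

end Limits

/-! ### Identification of the limit -/

theorem corollary5p5 (lam μ₁ μ₂ : ℝ) (hlam : 0 < lam) (h₁ : lam < μ₁) (h₂ : lam < μ₂) :
    -- `η` is the unique zero of `τ` in `(0, 1)`
    ∃ η : ℝ, (∀ z : ℝ, (0 < z ∧ z < 1 ∧ tandemTau lam μ₁ μ₂ z = 0) ↔ z = η) ∧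
    -- `R m` is Neuts's matrix and `r m` its Perron–Frobenius eigenvalue
    ∃ (R : ∀ m : ℕ, Matrix (Fin (m + 1)) (Fin (m + 1)) ℝ) (r : ℕ → ℝ),
      (∀ m, 1 ≤ m → (finiteTandem lam μ₁ μ₂ m).IsNeutsR (R m)) ∧
      (∀ m, 1 ≤ m → IsPerronFrobeniusEigenvalue (R m) (r m)) ∧
      -- `r 1, r 2, …` increases strictly, to `η` or to `ρ₂`
      StrictMonoOn r (Set.Ici 1) ∧
      (μ₁ ≤ μ₂ → Tendsto r atTop (𝓝 η)) ∧
      (μ₂ < μ₁ → Tendsto r atTop (𝓝 (lam / μ₂))) ∧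
      -- `r m` and `ρ₂` are the decay rates of the truncated and of the infinite system
      (∀ m, 1 ≤ m → (finiteTandem lam μ₁ μ₂ m).HasStationaryDecayRate (r m)) ∧
      (infiniteTandem lam μ₁ μ₂).HasStationaryDecayRate (lam / μ₂) ∧
      -- the limit of the truncated decay rates is not the decay rate of the infinite system
      (μ₁ < μ₂ → ∃ L : ℝ, Tendsto r atTop (𝓝 L) ∧ L ≠ lam / μ₂) := by
  have hμ₁ := hlam.trans h₁
  have hμ₂ := hlam.trans h₂
  obtain ⟨η, hη⟩ := exists_unique_zero_tandemTau hlam h₁ hμ₂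
  obtain ⟨hη0, hη1, hητ⟩ := (hη η).mpr rfl
  -- For `m = 0` the matrix and the number are set to zero; nothing is claimed about them.
  have hex : ∀ m : ℕ, ∃ (R : Matrix (Fin (m + 1)) (Fin (m + 1)) ℝ) (r : ℝ), 1 ≤ m → _ := fun m => by
    by_cases hm : 1 ≤ m
    · obtain ⟨R, r, h⟩ := exists_finiteTandem_neutsMatrix hlam h₁ h₂ hm
      exact ⟨R, r, fun _ => h⟩
    · exact ⟨0, 0, fun h => absurd h hm⟩
  choose R r hRr using hex
  have hr0 : ∀ m, 1 ≤ m → 0 < r m := fun m hm => (hRr m hm).2.1.pos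
  have hrρ : ∀ m, 1 ≤ m → r m < lam / μ₂ := fun m hm => (hRr m hm).2.2.2.1
  have hfpos : ∀ m, 1 ≤ m → ∀ n, n ≤ m → 0 < tandemSeq lam μ₁ μ₂ (r m) n :=
    fun m hm => (hRr m hm).2.2.2.2.1
  have hend := fun m hm => (hRr m hm).2.2.2.2.2.1
  have hmin := fun m hm => (hRr m hm).2.2.2.2.2.2
  have hρ1 : lam / μ₂ < 1 := (div_lt_one hμ₂).mpr h₂
  have hstep : ∀ m, 1 ≤ m → r m < r (m + 1) := by
    intro m hm
    have hm1 : 1 ≤ m + 1 := by omega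
    have hz := hr0 (m + 1) hm1
    have hzρ := hrρ (m + 1) hm1
    have hf := hfpos (m + 1) hm1
    have hzμ : μ₂ * r (m + 1) < μ₁ := by
      rw [lt_div_iff₀ hμ₂] at hzρ
      linarith
    have hlt := tandemSeq_boundary_lt hμ₁ hm hz (hzρ.trans hρ1) hzμ (hf (m + 1) le_rfl)
      (hend (m + 1) hm1)
    refine lt_of_le_of_ne ?_ fun heq => ?_
    · exact hmin m hm _ (tandemSeq lam μ₁ μ₂ (r (m + 1))) hz (fun n hn => hf n (by omega))
        (tandemSeq_one_eq hμ₁ _).le (fun n _ => (tandemSeq_add_two_eq hμ₁ _ n).le) hlt.le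
    · have := hend m hm
      rw [heq] at this
      exact hlt.ne this
  have hmono : StrictMonoOn r (Set.Ici 1) := by
    have h : StrictMono fun n => r (n + 1) :=
      strictMono_nat_of_lt_succ fun n => hstep (n + 1) (by omega)
    intro a ha b hb hab
    obtain ⟨a, rfl⟩ : ∃ n, a = n + 1 := ⟨a - 1, (Nat.sub_add_cancel ha).symm⟩
    obtain ⟨b, rfl⟩ : ∃ n, b = n + 1 := ⟨b - 1, (Nat.sub_add_cancel hb).symm⟩
    exact h (by omega)
  obtain ⟨L, hL⟩ : ∃ L, Tendsto r atTop (𝓝 L) := by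
    have hm : Monotone fun n => r (n + 1) :=
      monotone_nat_of_le_succ fun n => (hstep (n + 1) (by omega)).le
    have hb : BddAbove (Set.range fun n => r (n + 1)) := by
      refine ⟨lam / μ₂, ?_⟩
      rintro _ ⟨n, rfl⟩
      exact (hrρ (n + 1) (by omega)).le
    exact ⟨_, (tendsto_add_atTop_iff_nat 1).mp (tendsto_atTop_ciSup hm hb)⟩
  have hLle : ∀ c, (∀ m, 1 ≤ m → r m ≤ c) → L ≤ c := fun c hc =>
    le_of_tendsto hL ((eventually_ge_atTop 1).mono hc)
  have hLρ : L ≤ lam / μ₂ := hLle _ fun m hm => (hrρ m hm).le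
  have hL0 : 0 < L := by
    refine lt_of_lt_of_le (hr0 1 le_rfl) (ge_of_tendsto hL ?_)
    exact (eventually_ge_atTop 1).mono fun m hm =>
      hmono.monotoneOn (Set.mem_Ici.mpr le_rfl) hm hm
  -- For fixed `n`, positivity at all `r m` with `m ≥ n` survives in the limit as nonnegativity,
  -- which the recurrence upgrades.
  have hLf : ∀ n, 0 < tandemSeq lam μ₁ μ₂ L n := by
    refine tandemSeq_pos_of_nonneg hlam hμ₁ hL0 fun n => ?_
    refine ge_of_tendsto (((continuous_tandemSeq lam μ₁ μ₂ n).tendsto L).comp hL) ?_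
    exact (eventually_ge_atTop (max 1 n)).mono fun m hm =>
      (hfpos m (le_trans (le_max_left _ _) hm) n (le_trans (le_max_right _ _) hm)).le
  have hLτ := tandemTau_nonpos_of_forall_tandemSeq_pos hlam hμ₁ hL0 hLf
  have hηL : η ≤ L := by
    by_contra h
    exact (tandemTau_neg_of_lt hlam h₁ hμ₂ hL0 (not_le.mp h) hη1.le hLτ).ne hητ
  have hcase₁ : μ₁ ≤ μ₂ → L = η := by
    intro hμ
    refine le_antisymm (hLle η fun m hm => ?_) hηL
    -- Otherwise `τ`, nonpositive at `λ/μ₁`, would be negative at `η`.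
    have hημ : η * μ₁ ≤ lam := by
      rw [← le_div_iff₀ hμ₁]
      by_contra h
      have hτ : tandemTau lam μ₁ μ₂ (lam / μ₁) ≤ 0 := by
        rw [tandemTau_div_left hlam h₁]
        refine mul_nonpos_of_nonneg_of_nonpos (by linarith) ?_
        rw [sub_nonpos, one_le_div hμ₁]
        exact hμ
      exact (tandemTau_neg_of_lt hlam h₁ hμ₂ (div_pos hlam hμ₁) (not_le.mp h) hη1.le hτ).ne hητ
    obtain ⟨β, hβ, hβ0, hβ1, hβ2⟩ := geometric_superinvariant hlam h₁ hη0 hητ hημ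
    refine hmin m hm η (fun n => β ^ n) hη0 (fun n _ => pow_pos hβ n) (by simpa using hβ0)
      (fun n _ => ?_) ?_
    · refine le_of_eq ?_
      linear_combination β ^ n * hβ1
    · obtain ⟨n, rfl⟩ : ∃ n, m = n + 1 := ⟨m - 1, by omega⟩
      rw [Nat.add_sub_cancel]
      have := mul_le_mul_of_nonneg_right hβ2 (pow_pos hβ n).le
      rw [pow_succ]
      linarith
  have hcase₂ : μ₂ < μ₁ → L = lam / μ₂ := by
    intro hμ
    by_contra hne
    refine not_forall_tandemSeq_pos_of_lt hlam hμ₁ h₂ ?_ (lt_of_le_of_ne hLρ hne) hLf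
    -- `λ/μ₁ ≤ η`, because `τ` is positive at `λ/μ₁` and negative beyond `η`.
    refine le_trans ?_ hηL
    by_contra h
    have hτ := tandemTau_neg_of_lt hlam h₁ hμ₂ hη0 (not_le.mp h)
      ((div_lt_one hμ₁).mpr h₁).le hητ.le
    rw [tandemTau_div_left hlam h₁] at hτ
    have : 0 < (μ₁ - lam) * (1 - μ₂ / μ₁) :=
      mul_pos (by linarith) (sub_pos.mpr ((div_lt_one hμ₁).mpr hμ))
    linarith
  refine ⟨η, hη, R, r, fun m hm => (hRr m hm).1, fun m hm => (hRr m hm).2.1, hmono,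
    fun hμ => hcase₁ hμ ▸ hL, fun hμ => hcase₂ hμ ▸ hL, fun m hm => (hRr m hm).2.2.1,
    infiniteTandem_hasStationaryDecayRate hlam h₁ h₂, fun hμ => ⟨L, hL, ?_⟩⟩
  rw [hcase₁ hμ.le]
  intro h
  have := tandemTau_div_right_neg hlam hμ₁ hμ₂ hμ.ne
  rw [← h] at this
  exact this.ne hητ
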